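/- Let $(\Omega,\mathcal F,\mathbb P)$ be a probability space with a filtration $(\mathcal F_t)_{t\ge 0}$, let $T>0$ and $\lambda>0$, let $W$ be an $m$-dimensional $(\mathcal F_t)$-Brownian motion and let $N$ be a one-dimensional $(\mathcal F_t)$-Poisson process of intensity $\lambda$ (both are adapted, and for $s\le t$ each of the increments $W_t-W_s$ and $N_t-N_s$ is independent of $\mathcal F_s$). Put $\overline N_t=N_t-\lambda t$. Let $X_0:\Omega\to\mathbb R^d$ be $\mathcal F_0$-measurable with $\mathbb E\|X_0\|^p<\infty$ for all $p>0$. Let $f,h:\mathbb R^d\to\mathbb R^d$ and $g:\mathbb R^d\to\mathbb R^{d\times m}$ be $C^1$ functions (with the Euclidean norm on $\mathbb R^d$ and the operator norm on matrices), and let $C,K,c>0$ be constants such that, for all $x,y\in\mathbb R^d$, $$\|g(x)-g(y)\|\vee\|h(x)-h(y)\|\le C\|x-y\|,\qquad \langle x-y,f(x)-f(y)\rangle\le C\|x-y\|^2,$$ $$\|f(x)-f(y)\|\le C\,(K+\|x\|^c+\|y\|^c)\,\|x-y\|.$$ Set $f_\lambda=f+\lambda h$. For an integer $M\ge 1$ let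 $\Delta t=T/M$, $t_n=n\,\Delta t$, and define the compensated tamed Euler iterates by $Y_0^M=X_0$ and $$Y_{n+1}^M=Y_n^M+\frac{\Delta t\,f_\lambda(Y_n^M)}{1+\Delta t\,\|f_\lambda(Y_n^M)\|}+g(Y_n^M)\,(W_{t_{n+1}}-W_{t_n})+h(Y_n^M)\,(\overline N_{t_{n+1}}-\overline N_{t_n}),\qquad 0\le n<M.$$ Then each $Y_n^M$ is a random variable, and for every $p\in[1,\infty)$ $$\sup_{M\ge 1}\ \sup_{n\in\{0,\dots,M\}}\mathbb E\big[\|Y_n^M\|^p\big]<\infty .$$ -/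

import Mathlib

open MeasureTheory ProbabilityTheory
open scoped NNReal ENNReal RealInnerProductSpace

/-- `W` is an `m`-dimensional Brownian motion with respect to the filtration `ℱ`. -/
structure IsFilteredBrownianMotion {Ω : Type*} {mΩ : MeasurableSpace Ω} {m : ℕ}
    (W : ℝ≥0 → Ω → EuclideanSpace ℝ (Fin m)) (ℱ : Filtration ℝ≥0 mΩ) (P : Measure Ω) : Prop where
  adapted : ∀ t, Measurable[ℱ t] (W t)
  zero : ∀ᵐ ω ∂P, W 0 ω = 0
  continuous_paths : ∀ᵐ ω ∂P, Continuous fun t => W t ω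
  indep_increment : ∀ s t, s ≤ t →
    Indep (MeasurableSpace.comap (fun ω => W t ω - W s ω) inferInstance) (ℱ s) P
  /-- `W t - W s` is centred Gaussian with covariance matrix `(t - s)` times the identity. -/
  law_increment : ∀ s t : ℝ≥0, s ≤ t →
    HasLaw (fun ω => W t ω - W s ω)
      ((stdGaussian (EuclideanSpace ℝ (Fin m))).map fun z => √((t : ℝ) - s) • z) P

/-- `N` is a Poisson process of intensity `lam` with respect to the filtration `ℱ`: a counting
process (nondecreasing right-continuous paths with values in the natural numbers, started at `0`)
whose increment over `[s, t]` is independent of `ℱ s` and Poisson distributed with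
parameter `lam * (t - s)`. -/
structure IsFilteredPoissonProcess {Ω : Type*} {mΩ : MeasurableSpace Ω}
    (N : ℝ≥0 → Ω → ℕ) (lam : ℝ≥0) (ℱ : Filtration ℝ≥0 mΩ) (P : Measure Ω) : Prop where
  adapted : ∀ t, Measurable[ℱ t] (N t)
  zero : ∀ᵐ ω ∂P, N 0 ω = 0
  counting_paths : ∀ᵐ ω ∂P, Monotone (fun t => N t ω) ∧
    ∀ t, ContinuousWithinAt (fun r => N r ω) (Set.Ici t) t
  indep_increment : ∀ s t, s ≤ t →
    Indep (MeasurableSpace.comap (fun ω => (N t ω : ℝ) - N s ω) inferInstance) (ℱ s) P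
  law_increment : ∀ s t, s ≤ t →
    HasLaw (fun ω => (N t ω : ℝ) - N s ω)
      ((poissonMeasure (lam * (t - s))).map (Nat.cast : ℕ → ℝ)) P

/-- The compensated process `N t - lam * t`. -/
def compensated {Ω : Type*} (N : ℝ≥0 → Ω → ℕ) (lam : ℝ≥0) (t : ℝ≥0) (ω : Ω) : ℝ :=
  (N t ω : ℝ) - lam * t

/-- The compensated drift `f + lam * h`. -/
def compensatedDrift {E : Type*} [AddCommGroup E] [Module ℝ E] (f h : E → E) (lam : ℝ≥0)
    (x : E) : E :=
  f x + (lam : ℝ) • h x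

/-- The grid point `n * (T / M)`. -/
noncomputable def gridTime (T : ℝ≥0) (M n : ℕ) : ℝ≥0 := n * (T / M)

/-- The compensated tamed Euler iterates with `M` steps of size `T / M`, started at `X₀`. The
diffusion coefficient takes values in the linear maps from `ℝ^m` to `ℝ^d` (that is, the
`d × m` matrices with the operator norm). -/
noncomputable def compensatedTamedEuler {Ω : Type*} {d m : ℕ}
    (f : EuclideanSpace ℝ (Fin d) → EuclideanSpace ℝ (Fin d))
    (g : EuclideanSpace ℝ (Fin d) → EuclideanSpace ℝ (Fin m) →L[ℝ] EuclideanSpace ℝ (Fin d))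
    (h : EuclideanSpace ℝ (Fin d) → EuclideanSpace ℝ (Fin d))
    (lam T : ℝ≥0) (X₀ : Ω → EuclideanSpace ℝ (Fin d))
    (W : ℝ≥0 → Ω → EuclideanSpace ℝ (Fin m)) (N : ℝ≥0 → Ω → ℕ) (M : ℕ) :
    ℕ → Ω → EuclideanSpace ℝ (Fin d)
  | 0 => X₀
  | n + 1 => fun ω =>
    let y := compensatedTamedEuler f g h lam T X₀ W N M n ω
    let Δt : ℝ := T / M
    y + (Δt / (1 + Δt * ‖compensatedDrift f h lam y‖)) • compensatedDrift f h lam y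
      + g y (W (gridTime T M (n + 1)) ω - W (gridTime T M n) ω)
      + (compensated N lam (gridTime T M (n + 1)) ω - compensated N lam (gridTime T M n) ω) • h y

/-! The taming is harmless where `Δ * ‖b y‖ ^ 2 ≤ 1 + ‖y‖ ^ 2`, with `b` the compensated drift:
there the one-sided condition makes a noiseless step multiply `1 + ‖y‖ ^ 2` by at most `1 + O(Δ)`.
Elsewhere only the crude fact remains that a tamed step has length at most `1`. Both regimes are
handled by a single estimate for `ρ ^ 2 + ‖X‖ ^ 2`, with a free parameter `ρ ≥ 1`.

That estimate (`exists_integral_pow_step_le`) expands the `k`-th power to first order in the noise.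
The linear term has mean zero by independence from the past. The remainder contains only noise
powers of order at least two, whose means are `O(Δ)` for Gaussian and for compensated Poisson
increments alike. Each step thus costs a factor `1 + C * Δ`, and iterating over `M` steps with `M *
Δ ≤ T` costs at most `exp (C * T)`.

It is used twice in `exists_integral_pow_tamed_le`. With `ρ = 1` it bounds all moments, uniformly in
`M`, of the scheme `Z` frozen on leaving the good region. With `ρ = M` it applies to the tamed
scheme `Y` itself, since unit displacements change `M ^ 2 + ‖y‖ ^ 2` by a factor at most `1 + 2 /
M`; the moments of `Y` therefore grow at most polynomially in `M`.

If `Z n` is in the good region then `Y n = Z n`. If not, polynomial growth of `b` forces `M ≤ T * A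
* (1 + ‖Z n‖ ^ 2) ^ q`, so powers of `M` can be traded for moments of `Z`, which absorbs the
polynomial growth. -/

/-! ### Deterministic expansion of powers. -/

/-- First order expansion of a power, with a remainder that is linear in `Δ` and at least quadratic
in `z`. -/
lemma exists_abs_one_add_pow_sub_le {A T : ℝ} (hA : 0 ≤ A) (hT : 0 ≤ T) (k : ℕ) :
    ∃ D : ℝ, 0 ≤ D ∧ ∀ Δ z r : ℝ, 0 ≤ Δ → Δ ≤ T → 0 ≤ z → |r| ≤ A * z →
      |(1 + (A * Δ + r + A * z ^ 2)) ^ k - 1 - k * r| ≤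
        D * (Δ + z ^ 2 * (1 + z) ^ (2 * k)) := by
  induction k with
  | zero => exact ⟨0, le_rfl, by intros; simp⟩
  | succ k ih =>
    obtain ⟨D, hD, ih⟩ := ih
    refine ⟨(1 + A * T + A) * D * (2 + 2 * T + 1) + A + k * A * (A * (1 + T) + A),
      by positivity, fun Δ z r hΔ hΔT hz hr => ?_⟩
    have ih := ih Δ z r hΔ hΔT hz hr
    set η := A * Δ + r + A * z ^ 2 with hη
    set E := Δ + z ^ 2 * (1 + z) ^ (2 * (k + 1)) with hE
    have h1z : (1 : ℝ) ≤ 1 + z := by linarith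
    have hp : (1 : ℝ) ≤ (1 + z) ^ (2 * k) := one_le_pow₀ h1z
    have hpz : (1 + z) ^ 2 ≤ (1 + z) ^ (2 * (k + 1)) :=
      pow_le_pow_right₀ h1z (by omega)
    have hz2 : 0 ≤ z ^ 2 := sq_nonneg z
    have hE2 : Δ + z ^ 2 * (1 + z) ^ 2 ≤ E := by
      rw [hE]; gcongr
    have hE1 : Δ + z ^ 2 ≤ E := by
      refine le_trans ?_ hE2
      have : (1 : ℝ) ≤ (1 + z) ^ 2 := one_le_pow₀ h1z
      nlinarith
    have hAΔ : 0 ≤ A * Δ := by positivity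
    have hAz : 0 ≤ A * z := by positivity
    have hAz2 : 0 ≤ A * z ^ 2 := by positivity
    have hη1 : |1 + η| ≤ (1 + A * T + A) * (1 + z) ^ 2 := by
      have h1 : |1 + η| ≤ 1 + A * Δ + A * z + A * z ^ 2 := by
        obtain ⟨h2, h3⟩ := abs_le.1 hr
        rw [abs_le]; constructor <;> linarith
      have h2 : A * Δ ≤ A * T := by gcongr
      have h3 : 0 ≤ A * T := by positivity
      nlinarith [mul_nonneg h3 hz, mul_nonneg h3 hz2]
    have hηabs : |η| ≤ A * Δ + A * z + A * z ^ 2 := by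
      obtain ⟨h2, h3⟩ := abs_le.1 hr
      rw [abs_le]; constructor <;> linarith
    have hηr : |η - r| ≤ A * E := by
      rw [abs_of_nonneg (by rw [hη]; linarith)]
      have : A * (Δ + z ^ 2) ≤ A * E := by gcongr
      rw [hη]; linarith
    have hkηr : |k * (η * r)| ≤ k * A * (A * (1 + T) + A) * E := by
      rw [abs_mul, abs_mul, Nat.abs_cast]
      have h1 : |η| * |r| ≤ (A * Δ + A * z + A * z ^ 2) * (A * z) := by gcongr
      have h2 : (Δ + z + z ^ 2) * z ≤ (1 + T + 1) * E := by
        have h3 : Δ * z ≤ Δ + Δ * z ^ 2 := by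
          nlinarith [mul_nonneg hΔ (sq_nonneg (z - 1)), mul_nonneg hΔ hz2]
        have h4 : Δ * z ^ 2 ≤ T * z ^ 2 := by gcongr
        have h5 : z ^ 2 + z ^ 2 * z ≤ z ^ 2 * (1 + z) ^ 2 := by
          nlinarith [mul_nonneg hz2 hz, mul_nonneg hz2 hz2]
        have h6 : T * z ^ 2 ≤ T * E := by gcongr; linarith
        nlinarith
      calc (k : ℝ) * (|η| * |r|) ≤ k * ((A * Δ + A * z + A * z ^ 2) * (A * z)) := by gcongr
        _ = k * A * A * ((Δ + z + z ^ 2) * z) := by ring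
        _ ≤ k * A * A * ((1 + T + 1) * E) := by gcongr
        _ = _ := by ring
    have hmain : |(1 + η) * ((1 + η) ^ k - 1 - k * r)| ≤
        (1 + A * T + A) * D * (2 + 2 * T + 1) * E := by
      rw [abs_mul]
      have h7 : (1 + z) ^ 2 * (Δ + z ^ 2 * (1 + z) ^ (2 * k)) ≤ (2 + 2 * T + 1) * E := by
        have h8 : z ^ 2 * (1 + z) ^ (2 * k) * (1 + z) ^ 2 ≤ E := by
          rw [hE, mul_assoc, ← pow_add, mul_add, mul_one]; linarith
        have h9 : Δ * (1 + z) ^ 2 ≤ (2 + 2 * T) * E := by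
          have h10 : Δ * z ^ 2 ≤ T * z ^ 2 := by gcongr
          have h11 : T * (Δ + z ^ 2) ≤ T * E := by gcongr
          nlinarith [mul_nonneg hΔ (sq_nonneg (z - 1)), mul_nonneg hT hΔ]
        nlinarith
      calc |1 + η| * |(1 + η) ^ k - 1 - k * r|
          ≤ ((1 + A * T + A) * (1 + z) ^ 2) * (D * (Δ + z ^ 2 * (1 + z) ^ (2 * k))) := by
            gcongr
        _ = (1 + A * T + A) * D * ((1 + z) ^ 2 * (Δ + z ^ 2 * (1 + z) ^ (2 * k))) := by ring
        _ ≤ (1 + A * T + A) * D * ((2 + 2 * T + 1) * E) := by gcongr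
        _ = _ := by ring
    -- The three summands are the propagated error, the non-linear part of `η`, and the second-order
    -- product; they account for the three parts of the constant, in this order.
    have heq : (1 + η) ^ (k + 1) - 1 - ((k + 1 : ℕ) : ℝ) * r =
        (1 + η) * ((1 + η) ^ k - 1 - k * r) + (η - r) + k * (η * r) := by
      push_cast; ring
    rw [heq]
    refine (abs_add_le _ _).trans ((add_le_add (abs_add_le _ _) le_rfl).trans ?_)
    linarith

lemma sq_mul_one_add_pow_le {z : ℝ} (hz : 0 ≤ z) (j : ℕ) :
    z ^ 2 * (1 + z) ^ j ≤ 2 ^ j * (z ^ 2 + z ^ (j + 2)) := by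
  have h1 : (1 + z) ^ j ≤ 2 ^ j * (1 + z ^ j) := by
    refine (add_pow_le zero_le_one hz j).trans ?_
    rw [one_pow]
    gcongr
    · exact one_le_two
    · omega
  calc z ^ 2 * (1 + z) ^ j ≤ z ^ 2 * (2 ^ j * (1 + z ^ j)) := by gcongr
    _ = _ := by ring

lemma add_pow_le_two_pow_mul {a b : ℝ} (ha : 0 ≤ a) (hb : 0 ≤ b) (j : ℕ) :
    (a + b) ^ j ≤ 2 ^ j * (a ^ j + b ^ j) := by
  refine (add_pow_le ha hb j).trans ?_
  gcongr
  · exact one_le_two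
  · omega

/-- One step of a perturbed recursion: the `k`-th power of `ρ² + ‖a + ξ‖²` is bounded by that of
`u`, up to a term linear in `ξ` and a remainder. -/
lemma exists_pow_add_norm_sq_le (E : Type*) [NormedAddCommGroup E] [InnerProductSpace ℝ E]
    {A T : ℝ} (hA : 0 ≤ A) (hT : 0 ≤ T) (k : ℕ) :
    ∃ D : ℝ, 0 ≤ D ∧ ∀ (a ξ : E) (ρ u Δ z₁ z₂ : ℝ), 0 < u → 0 ≤ Δ → Δ ≤ T → 0 ≤ z₁ → 0 ≤ z₂ →
      ρ ^ 2 + ‖a‖ ^ 2 ≤ (1 + A * Δ) * u → ‖ξ‖ ≤ A * √u * (z₁ + z₂) →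
      (ρ ^ 2 + ‖a + ξ‖ ^ 2) ^ k ≤ u ^ k + 2 * k * u ^ (k - 1) * ⟪a, ξ⟫ +
        D * u ^ k * (Δ + (z₁ ^ 2 + z₁ ^ (2 * k + 2)) + (z₂ ^ 2 + z₂ ^ (2 * k + 2))) := by
  -- `A` serves the `Δ` term, `A ^ 2` the square of `‖ξ‖`, and the last summand the inner product of
  -- `a` and `ξ`.
  set A' := A + A ^ 2 + 2 * ((1 + A * T) * A) with hA'
  have hA'0 : 0 ≤ A' := by positivity
  obtain ⟨D, hD, hexp⟩ := exists_abs_one_add_pow_sub_le hA'0 hT k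
  refine ⟨D * (1 + 2 ^ (2 * k) * (2 ^ 2 + 2 ^ (2 * k + 2))), by positivity, ?_⟩
  intro a ξ ρ u Δ z₁ z₂ hu hΔ hΔT hz₁ hz₂ ha hξ
  set z := z₁ + z₂ with hz
  have hz0 : 0 ≤ z := by positivity
  set r := 2 * ⟪a, ξ⟫ / u with hr
  have hsu : √u ^ 2 = u := Real.sq_sqrt hu.le
  have hsu0 : 0 ≤ √u := Real.sqrt_nonneg u
  have ha' : ‖a‖ ≤ (1 + A * T) * √u := by
    apply le_of_sq_le_sq _ (by positivity)
    have h1 : A * Δ ≤ A * T := by gcongr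
    have h2 : 0 ≤ A * T := by positivity
    calc ‖a‖ ^ 2 ≤ (1 + A * Δ) * u := by nlinarith [sq_nonneg ρ]
      _ ≤ (1 + A * T) ^ 2 * u := by
        gcongr; nlinarith
      _ = _ := by rw [mul_pow, hsu]
  have hrz : |r| ≤ A' * z := by
    rw [hr, abs_div, abs_of_pos hu, div_le_iff₀ hu, abs_mul, abs_two]
    have h1 : |⟪a, ξ⟫| ≤ ((1 + A * T) * √u) * (A * √u * z) :=
      (abs_real_inner_le_norm a ξ).trans (by gcongr)
    have h2 : ((1 + A * T) * √u) * (A * √u * z) = (1 + A * T) * A * z * u := by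
      rw [← hsu]; simp only [Real.sqrt_sq hsu0]; ring
    have h3 : 0 ≤ (A + A ^ 2) * z * u := by positivity
    rw [h2] at h1
    rw [hA']; nlinarith
  have hs : ρ ^ 2 + ‖a + ξ‖ ^ 2 ≤ u * (1 + (A' * Δ + r + A' * z ^ 2)) := by
    have h1 : ‖ξ‖ ^ 2 ≤ A ^ 2 * u * z ^ 2 := by
      calc ‖ξ‖ ^ 2 ≤ (A * √u * z) ^ 2 := by gcongr
        _ = _ := by rw [mul_pow, mul_pow, hsu]
    have h2 : u * r = 2 * ⟪a, ξ⟫ := by rw [hr]; field_simp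
    have h3 : A * Δ * u ≤ A' * Δ * u := by
      gcongr; rw [hA']; have : 0 ≤ A ^ 2 + 2 * ((1 + A * T) * A) := by positivity
      linarith
    have h4 : A ^ 2 * u * z ^ 2 ≤ A' * u * z ^ 2 := by
      gcongr; rw [hA']; have : 0 ≤ A + 2 * ((1 + A * T) * A) := by positivity
      linarith
    rw [norm_add_sq_real]
    nlinarith
  -- For `k = 0` the truncated exponent `k - 1` is harmless, since the factor `k` vanishes.
  have hk : u ^ k * (k * r) = 2 * k * u ^ (k - 1) * ⟪a, ξ⟫ := by
    rcases k with _ | k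
    · simp
    · rw [hr, Nat.add_sub_cancel]; field_simp; ring
  -- The powers of `z₁ + z₂` are split into separate powers of `z₁` and `z₂`, so that no mixed
  -- moment of the two noises, hence no joint law, is ever needed.
  have hR : Δ + z ^ 2 * (1 + z) ^ (2 * k) ≤ (1 + 2 ^ (2 * k) * (2 ^ 2 + 2 ^ (2 * k + 2))) *
      (Δ + (z₁ ^ 2 + z₁ ^ (2 * k + 2)) + (z₂ ^ 2 + z₂ ^ (2 * k + 2))) := by
    have h1 := sq_mul_one_add_pow_le hz0 (2 * k)
    have h2 := add_pow_le_two_pow_mul hz₁ hz₂ 2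
    have h3 := add_pow_le_two_pow_mul hz₁ hz₂ (2 * k + 2)
    set S := (z₁ ^ 2 + z₁ ^ (2 * k + 2)) + (z₂ ^ 2 + z₂ ^ (2 * k + 2)) with hS
    have h4 : z ^ 2 + z ^ (2 * k + 2) ≤ (2 ^ 2 + 2 ^ (2 * k + 2)) * S := by
      have e1 : z₁ ^ 2 + z₂ ^ 2 ≤ S := by
        have := pow_nonneg hz₁ (2 * k + 2); have := pow_nonneg hz₂ (2 * k + 2)
        rw [hS]; linarith
      have e2 : z₁ ^ (2 * k + 2) + z₂ ^ (2 * k + 2) ≤ S := by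
        have := pow_nonneg hz₁ 2; have := pow_nonneg hz₂ 2
        rw [hS]; linarith
      calc z ^ 2 + z ^ (2 * k + 2) ≤ 2 ^ 2 * S + 2 ^ (2 * k + 2) * S :=
            add_le_add (h2.trans (by gcongr)) (h3.trans (by gcongr))
        _ = _ := by ring
    have hS0 : 0 ≤ S := by positivity
    have h5 : (2 : ℝ) ^ (2 * k) * (z ^ 2 + z ^ (2 * k + 2)) ≤
        2 ^ (2 * k) * ((2 ^ 2 + 2 ^ (2 * k + 2)) * S) := by gcongr
    have h6 : 0 ≤ (2 : ℝ) ^ (2 * k) * (2 ^ 2 + 2 ^ (2 * k + 2)) * Δ := by positivity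
    rw [add_assoc Δ, ← hS]
    linarith
  calc (ρ ^ 2 + ‖a + ξ‖ ^ 2) ^ k ≤ (u * (1 + (A' * Δ + r + A' * z ^ 2))) ^ k := by
        gcongr
    _ = u ^ k * (1 + (A' * Δ + r + A' * z ^ 2)) ^ k := mul_pow _ _ _
    _ ≤ u ^ k * (1 + k * r + D * (Δ + z ^ 2 * (1 + z) ^ (2 * k))) := by
        gcongr
        have := (abs_le.1 (hexp Δ z r hΔ hΔT hz0 hrz)).2
        linarith
    _ ≤ u ^ k * (1 + k * r + D * ((1 + 2 ^ (2 * k) * (2 ^ 2 + 2 ^ (2 * k + 2))) *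
      (Δ + (z₁ ^ 2 + z₁ ^ (2 * k + 2)) + (z₂ ^ 2 + z₂ ^ (2 * k + 2))))) := by gcongr
    _ = _ := by rw [← hk]; ring

/-! ### Moments of Gaussian and compensated Poisson increments. -/

/-- A centred random variable with moments of all orders, those of order at least two being
bounded by a multiple of `Δ`. -/
structure IsSmallNoise {Ω F : Type*} {mΩ : MeasurableSpace Ω} [NormedAddCommGroup F]
    [NormedSpace ℝ F] (Q : ℕ → ℝ) (Δ : ℝ) (ξ : Ω → F) (P : Measure Ω) : Prop where
  integrable : Integrable ξ P
  integrable_pow : ∀ j : ℕ, Integrable (fun ω => ‖ξ ω‖ ^ j) P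
  integral_eq_zero : ∫ ω, ξ ω ∂P = 0
  integral_pow_le : ∀ j : ℕ, 2 ≤ j → ∫ ω, ‖ξ ω‖ ^ j ∂P ≤ Q j * Δ

section Noise

variable {Ω : Type*} {mΩ : MeasurableSpace Ω} {P : Measure Ω}

lemma integrable_norm_pow_stdGaussian (F : Type*) [NormedAddCommGroup F] [InnerProductSpace ℝ F]
    [FiniteDimensional ℝ F] [MeasurableSpace F] [BorelSpace F] (j : ℕ) :
    Integrable (fun z : F => ‖z‖ ^ j) (stdGaussian F) := by
  have h : MemLp (id : F → F) (j : ℝ≥0∞) (stdGaussian F) :=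
    IsGaussian.memLp_id _ _ (ENNReal.natCast_ne_top j)
  exact h.integrable_norm_pow'

lemma isSmallNoise_of_hasLaw_stdGaussian {F : Type*} [NormedAddCommGroup F]
    [InnerProductSpace ℝ F] [FiniteDimensional ℝ F] [MeasurableSpace F] [BorelSpace F]
    {ξ : Ω → F} {Δ T : ℝ} (hΔ : 0 ≤ Δ) (hΔT : Δ ≤ T)
    (hξ : HasLaw ξ ((stdGaussian F).map fun z => √Δ • z) P) :
    IsSmallNoise (fun j => √T ^ (j - 2) * ∫ z : F, ‖z‖ ^ j ∂(stdGaussian F)) Δ ξ P := by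
  have hm : Measurable fun z : F => √Δ • z := by fun_prop
  have hint : ∀ j : ℕ, Integrable (fun x : F => ‖x‖ ^ j)
      ((stdGaussian F).map fun z => √Δ • z) := fun j => by
    rw [integrable_map_measure (by fun_prop) hm.aemeasurable]
    simp only [Function.comp_def, norm_smul, mul_pow]
    exact (integrable_norm_pow_stdGaussian F j).const_mul _
  have hint1 : Integrable (fun x : F => x) ((stdGaussian F).map fun z => √Δ • z) := by
    rw [← integrable_norm_iff (by fun_prop)]
    simpa using hint 1
  constructor
  · rw [← hξ.map_eq] at hint1
    exact hint1.comp_aemeasurable hξ.aemeasurable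
  · intro j
    have := hint j
    rw [← hξ.map_eq] at this
    exact this.comp_aemeasurable hξ.aemeasurable
  · rw [hξ.integral_eq, integral_map hm.aemeasurable (by fun_prop), integral_smul,
      integral_id_stdGaussian, smul_zero]
  · intro j hj
    have h1 := hξ.integral_comp (f := fun x : F => ‖x‖ ^ j) (by fun_prop)
    simp only [Function.comp_def] at h1
    rw [h1, integral_map hm.aemeasurable (by fun_prop)]
    simp only [norm_smul, mul_pow, Real.norm_eq_abs, abs_of_nonneg (Real.sqrt_nonneg Δ)]
    rw [integral_const_mul]
    -- Two of the `j` factors `√Δ` give `Δ`; the others are bounded by `√T`.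
    have h2 : √Δ ^ j ≤ √T ^ (j - 2) * Δ := by
      obtain ⟨i, rfl⟩ := Nat.exists_eq_add_of_le hj
      rw [pow_add, Real.sq_sqrt hΔ, Nat.add_sub_cancel_left, mul_comm]
      gcongr
    have h3 : 0 ≤ ∫ z : F, ‖z‖ ^ j ∂(stdGaussian F) := integral_nonneg fun _ => by positivity
    nlinarith

lemma hasSum_exp_poissonMeasure (r : ℝ≥0) :
    HasSum (fun n : ℕ => Real.exp (-r) * r ^ n / n.factorial * Real.exp n)
      (Real.exp (r * (Real.exp 1 - 1))) := by
  have h := (NormedSpace.expSeries_div_hasSum_exp (r * Real.exp 1 : ℝ)).mul_left (Real.exp (-r))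
  rw [← Real.exp_eq_exp_ℝ, ← Real.exp_add] at h
  convert! h using 1
  · ext n
    rw [mul_pow, ← Real.exp_nat_mul, mul_one]
    ring
  · congr 1; ring

lemma integrable_exp_poissonMeasure (r : ℝ≥0) :
    Integrable (fun n : ℕ => Real.exp n) (poissonMeasure r) := by
  rw [integrable_poissonMeasure_iff]
  simpa using (hasSum_exp_poissonMeasure r).summable

lemma integral_exp_poissonMeasure (r : ℝ≥0) :
    ∫ n : ℕ, Real.exp n ∂(poissonMeasure r) = Real.exp (r * (Real.exp 1 - 1)) := by
  rw [integral_poissonMeasure]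
  simpa using (hasSum_exp_poissonMeasure r).tsum_eq

lemma integrable_pow_poissonMeasure (r : ℝ≥0) (j : ℕ) :
    Integrable (fun n : ℕ => (n : ℝ) ^ j) (poissonMeasure r) := by
  refine ((integrable_exp_poissonMeasure r).const_mul (j.factorial : ℝ)).mono' (by fun_prop)
    (ae_of_all _ fun n => ?_)
  have := Real.pow_div_factorial_le_exp (n : ℝ) n.cast_nonneg j
  rw [div_le_iff₀ (by positivity)] at this
  rw [Real.norm_of_nonneg (by positivity)]
  linarith

/-- The exponential series contains both `1` and `n ^ j / j!` when `j ≠ 0`, so `n ^ j ≤ j! * (exp n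
- 1)`. The mean of `exp n - 1` is `exp x - 1` with `x = r * (e - 1)`, and `exp x - 1 ≤ x * exp x`
makes it linear in `r`. Subtracting the `1` is what produces the factor `r`. -/
lemma integral_pow_poissonMeasure_le {r : ℝ≥0} {R : ℝ} (hr : r ≤ R) {j : ℕ} (hj : j ≠ 0) :
    ∫ n : ℕ, (n : ℝ) ^ j ∂(poissonMeasure r) ≤
      j.factorial * ((Real.exp 1 - 1) * Real.exp (R * (Real.exp 1 - 1))) * r := by
  have he : 0 ≤ Real.exp 1 - 1 := by linarith [Real.add_one_le_exp 1]
  have h1 : ∫ n : ℕ, (n : ℝ) ^ j ∂(poissonMeasure r) ≤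
      ∫ n : ℕ, j.factorial * (Real.exp n - 1) ∂(poissonMeasure r) := by
    refine integral_mono (integrable_pow_poissonMeasure r j)
      (((integrable_exp_poissonMeasure r).sub (integrable_const 1)).const_mul _) fun n => ?_
    have h2 : (n : ℝ) ^ j / j.factorial + 1 ≤ Real.exp n := by
      have h3 := Real.sum_le_exp_of_nonneg (x := (n : ℝ)) n.cast_nonneg (j + 1)
      refine le_trans ?_ h3
      rw [Finset.sum_range_succ, add_comm]
      gcongr
      obtain ⟨i, rfl⟩ := Nat.exists_eq_succ_of_ne_zero hj
      rw [Finset.sum_range_succ']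
      simp only [pow_zero, Nat.factorial_zero, Nat.cast_one, div_one, le_add_iff_nonneg_left]
      exact Finset.sum_nonneg fun _ _ => by positivity
    have h4 : (n : ℝ) ^ j / j.factorial ≤ Real.exp n - 1 := by linarith
    rw [div_le_iff₀ (by positivity)] at h4
    simpa [mul_comm] using h4
  refine h1.trans ?_
  rw [integral_const_mul, integral_sub (integrable_exp_poissonMeasure r) (integrable_const 1),
    integral_exp_poissonMeasure]
  simp only [integral_const, probReal_univ, smul_eq_mul, mul_one]
  rw [mul_assoc]
  gcongr
  set x := (r : ℝ) * (Real.exp 1 - 1) with hx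
  have hx0 : 0 ≤ x := by positivity
  have h5 : Real.exp x - 1 ≤ x * Real.exp x := by
    have h6 := Real.add_one_le_exp (-x)
    rw [Real.exp_neg] at h6
    have h7 := Real.exp_pos x
    have h8 : (Real.exp x)⁻¹ * Real.exp x = 1 := inv_mul_cancel₀ h7.ne'
    nlinarith
  have h9 : Real.exp x ≤ Real.exp (R * (Real.exp 1 - 1)) := by
    rw [hx]; gcongr
  calc Real.exp x - 1 ≤ x * Real.exp x := h5
    _ ≤ x * Real.exp (R * (Real.exp 1 - 1)) := by gcongr
    _ = _ := by rw [hx]; ring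

lemma integral_natCast_poissonMeasure (r : ℝ≥0) :
    ∫ n : ℕ, (n : ℝ) ∂(poissonMeasure r) = r := by
  rw [integral_poissonMeasure]
  refine HasSum.tsum_eq ?_
  -- The term at `0` vanishes, and the shifted series is `r` times the total mass of the Poisson
  -- law.
  rw [← hasSum_nat_add_iff' 1]
  have h := (hasSum_one_poissonMeasure r).mul_left (r : ℝ)
  simp only [mul_one] at h
  convert! h using 1
  · ext n
    rw [Nat.factorial_succ]
    push_cast
    simp only [smul_eq_mul]
    field_simp
    ring
  · simp

lemma isSmallNoise_of_hasLaw_poissonMeasure {X : Ω → ℝ} {lam δ : ℝ≥0} {T : ℝ}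
    (hδ : δ ≤ T) (hX : HasLaw X ((poissonMeasure (lam * δ)).map (Nat.cast : ℕ → ℝ)) P) :
    IsSmallNoise (fun j => 2 ^ j * (j.factorial *
      ((Real.exp 1 - 1) * Real.exp (lam * T * (Real.exp 1 - 1))) + (lam * T) ^ (j - 1)) * lam)
      δ (fun ω => X ω - lam * δ) P := by
  set μ : ℝ≥0 := lam * δ with hμ
  have hμ' : (lam : ℝ) * δ = μ := by rw [hμ]; push_cast; rfl
  rw [hμ']
  have hμT : (μ : ℝ) ≤ lam * T := by rw [← hμ']; gcongr
  have hbound : ∀ (j : ℕ) (n : ℕ), ‖(n : ℝ) - μ‖ ^ j ≤ 2 ^ j * ((n : ℝ) ^ j + (μ : ℝ) ^ j) := by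
    intro j n
    refine le_trans ?_ (add_pow_le_two_pow_mul n.cast_nonneg μ.coe_nonneg j)
    gcongr
    refine (norm_sub_le _ _).trans ?_
    simp
  have hdom : ∀ j : ℕ, Integrable (fun n : ℕ => (2 : ℝ) ^ j * ((n : ℝ) ^ j + (μ : ℝ) ^ j))
      (poissonMeasure μ) := fun j =>
    ((integrable_pow_poissonMeasure μ j).add (integrable_const _)).const_mul _
  have hint : ∀ j : ℕ, Integrable (fun n : ℕ => ‖(n : ℝ) - μ‖ ^ j) (poissonMeasure μ) := fun j =>
    (hdom j).mono' (by fun_prop) (ae_of_all _ fun n => by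
      rw [Real.norm_of_nonneg (by positivity)]; exact hbound j n)
  have hcast : Measurable (Nat.cast : ℕ → ℝ) := by fun_prop
  have hintX : ∀ g : ℝ → ℝ, Measurable g → Integrable (fun n : ℕ => g n) (poissonMeasure μ) →
      Integrable (fun ω => g (X ω)) P := fun g hg h => by
    have h2 : Integrable g ((poissonMeasure μ).map (Nat.cast : ℕ → ℝ)) :=
      (integrable_map_measure hg.aestronglyMeasurable hcast.aemeasurable).2 h
    rw [← hX.map_eq] at h2
    exact h2.comp_aemeasurable hX.aemeasurable
  have hintegral : ∀ g : ℝ → ℝ, Measurable g →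
      ∫ ω, g (X ω) ∂P = ∫ n : ℕ, g n ∂(poissonMeasure μ) := fun g hg => by
    have h1 := hX.integral_comp (f := g) hg.aestronglyMeasurable
    simp only [Function.comp_def] at h1
    rw [h1, integral_map hcast.aemeasurable hg.aestronglyMeasurable]
  have hid : Integrable (fun n : ℕ => (n : ℝ)) (poissonMeasure μ) := by
    simpa using integrable_pow_poissonMeasure μ 1
  constructor
  · exact hintX (fun x => x - μ) (by fun_prop) (hid.sub (integrable_const _))
  · exact fun j => hintX (fun x => ‖x - μ‖ ^ j) (by fun_prop) (hint j)
  · rw [hintegral (fun x => x - μ) (by fun_prop), integral_sub hid (integrable_const _),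
      integral_natCast_poissonMeasure]
    simp
  · intro j hj
    rw [hintegral (fun x => ‖x - μ‖ ^ j) (by fun_prop)]
    refine (integral_mono (hint j) (hdom j) (hbound j)).trans ?_
    rw [integral_const_mul, integral_add (integrable_pow_poissonMeasure μ j) (integrable_const _)]
    simp only [integral_const, probReal_univ, smul_eq_mul, one_mul]
    have h1 := integral_pow_poissonMeasure_le hμT (show j ≠ 0 by omega)
    have h2 : (μ : ℝ) ^ j ≤ (lam * T) ^ (j - 1) * μ := by
      obtain ⟨i, rfl⟩ := Nat.exists_eq_add_of_le' (show 1 ≤ j by omega)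
      rw [pow_succ, Nat.add_sub_cancel]
      gcongr
    rw [mul_assoc _ _ (δ : ℝ), hμ', mul_assoc]
    gcongr
    linarith

end Noise

/-! ### Moment growth over one step. -/

section OneStep

variable {Ω 𝓧 E F : Type*} {mΩ : MeasurableSpace Ω} {P : Measure Ω} [MeasurableSpace 𝓧]
  [NormedAddCommGroup F] [InnerProductSpace ℝ F]

/-- A random linear functional independent of a centred random vector, applied to that vector,
is centred. -/
lemma integral_clm_apply_eq_zero [FiniteDimensional ℝ F] [MeasurableSpace F] [BorelSpace F]
    {X : Ω → 𝓧} {w : Ω → F} (hind : IndepFun X w P)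
    (hX : Measurable X) (hw : Integrable w P) (hw0 : ∫ ω, w ω ∂P = 0)
    {V : 𝓧 → F →L[ℝ] ℝ} (hV : Measurable V) {b : Ω → ℝ} (hb : Integrable b P)
    (hVb : ∀ ω, ‖V (X ω)‖ ≤ b ω) :
    Integrable (fun ω => V (X ω) (w ω)) P ∧ ∫ ω, V (X ω) (w ω) ∂P = 0 := by
  have : ProperSpace (F →L[ℝ] ℝ) := FiniteDimensional.proper ℝ _
  have hVX : Integrable (fun ω => V (X ω)) P :=
    hb.mono' (hV.comp hX).aestronglyMeasurable (ae_of_all _ hVb)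
  have hind' : IndepFun (fun ω => V (X ω)) w P := hind.comp hV measurable_id
  refine ⟨hind'.integrable_bilin hVX hw (ContinuousLinearMap.id ℝ (F →L[ℝ] ℝ)), ?_⟩
  have h := hind'.integral_bilin hVX hw (ContinuousLinearMap.id ℝ (F →L[ℝ] ℝ))
  rw [hw0, map_zero] at h
  exact h

lemma integral_mul_noise_le [MeasurableSpace F] [BorelSpace F] {X : Ω → 𝓧} {w : Ω → F} (hind : IndepFun X w P)
    {Q : ℕ → ℝ} {Δ : ℝ} (hw : IsSmallNoise Q Δ w P)
    {φ : 𝓧 → ℝ} (hφ : Measurable φ) (hφ0 : ∀ y, 0 ≤ φ y)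
    (hφX : Integrable (fun ω => φ (X ω)) P) {j : ℕ} (hj : 2 ≤ j) :
    Integrable (fun ω => φ (X ω) * ‖w ω‖ ^ j) P ∧
      ∫ ω, φ (X ω) * ‖w ω‖ ^ j ∂P ≤ Q j * Δ * ∫ ω, φ (X ω) ∂P := by
  have hind' : IndepFun (fun ω => φ (X ω)) (fun ω => ‖w ω‖ ^ j) P :=
    hind.comp (ψ := fun x => ‖x‖ ^ j) hφ (by fun_prop)
  refine ⟨hind'.integrable_mul hφX (hw.integrable_pow j), ?_⟩
  rw [hind'.integral_fun_mul_eq_mul_integral hφX.aestronglyMeasurable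
    (hw.integrable_pow j).aestronglyMeasurable, mul_comm]
  exact mul_le_mul_of_nonneg_right (hw.integral_pow_le j hj) (integral_nonneg fun ω => hφ0 _)

/-- One step of a recursion driven by two small noises, each independent of the current value:
the moments of `ρ² + ‖X‖²` grow by a factor `1 + C * Δ`, with `C` depending neither on `ρ` nor on
`Δ`. -/
lemma exists_integral_pow_step_le [IsProbabilityMeasure P]
    [NormedAddCommGroup E] [InnerProductSpace ℝ E] [FiniteDimensional ℝ E]
    [MeasurableSpace E] [BorelSpace E]
    [FiniteDimensional ℝ F] [MeasurableSpace F] [BorelSpace F]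
    {A T : ℝ} (hA : 0 ≤ A) (hT : 0 ≤ T) (Q₁ Q₂ : ℕ → ℝ) (k : ℕ) :
    ∃ C : ℝ, 0 ≤ C ∧ ∀ (X : Ω → E) (w : Ω → F) (ν : Ω → ℝ) (a κ : E → E) (γ : E → F →L[ℝ] E)
      (ρ Δ : ℝ), 1 ≤ ρ → 0 ≤ Δ → Δ ≤ T → Measurable X → Measurable w → Measurable ν →
      Measurable a → Measurable κ → Measurable γ → IndepFun X w P → IndepFun X ν P →
      IsSmallNoise Q₁ Δ w P → IsSmallNoise Q₂ Δ ν P →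
      (∀ y, ρ ^ 2 + ‖a y‖ ^ 2 ≤ (1 + A * Δ) * (ρ ^ 2 + ‖y‖ ^ 2)) →
      (∀ y, ‖γ y‖ ≤ A * √(ρ ^ 2 + ‖y‖ ^ 2)) → (∀ y, ‖κ y‖ ≤ A * √(ρ ^ 2 + ‖y‖ ^ 2)) →
      (∀ j : ℕ, Integrable (fun ω => (ρ ^ 2 + ‖X ω‖ ^ 2) ^ j) P) →
      Integrable (fun ω => (ρ ^ 2 + ‖a (X ω) + (γ (X ω) (w ω) + ν ω • κ (X ω))‖ ^ 2) ^ k) P ∧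
      ∫ ω, (ρ ^ 2 + ‖a (X ω) + (γ (X ω) (w ω) + ν ω • κ (X ω))‖ ^ 2) ^ k ∂P ≤
        (1 + C * Δ) * ∫ ω, (ρ ^ 2 + ‖X ω‖ ^ 2) ^ k ∂P := by
  have : ProperSpace E := FiniteDimensional.proper ℝ _
  have : ProperSpace F := FiniteDimensional.proper ℝ _
  have : ProperSpace (F →L[ℝ] E) := FiniteDimensional.proper ℝ _
  obtain ⟨D, hD, hstep⟩ := exists_pow_add_norm_sq_le E hA hT k
  -- Absolute values appear because `Q₁` and `Q₂` are not assumed nonnegative.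
  refine ⟨D * (1 + (|Q₁ 2| + |Q₁ (2 * k + 2)|) + (|Q₂ 2| + |Q₂ (2 * k + 2)|)), by positivity, ?_⟩
  intro X w ν a κ γ ρ Δ hρ hΔ hΔT hX hw hν ha hκ hγ hXw hXν hNw hNν haA hγA hκA hint
  set u : E → ℝ := fun y => ρ ^ 2 + ‖y‖ ^ 2 with hu
  have hu1 : ∀ y, 1 ≤ u y := fun y => by
    have : 1 ≤ ρ ^ 2 := one_le_pow₀ hρ
    simp only [hu]; nlinarith [sq_nonneg ‖y‖]
  have hu0 : ∀ y, 0 < u y := fun y => zero_lt_one.trans_le (hu1 y)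
  have hum : Measurable u := by fun_prop
  have hna : ∀ y, ‖a y‖ ≤ (1 + A * T) * √(u y) := fun y => by
    apply le_of_sq_le_sq _ (by positivity)
    have h1 : A * Δ ≤ A * T := by gcongr
    have h2 : 0 ≤ A * T := by positivity
    calc ‖a y‖ ^ 2 ≤ (1 + A * Δ) * u y := by nlinarith [sq_nonneg ρ, haA y]
      _ ≤ (1 + A * T) ^ 2 * u y := by
        have := (hu0 y).le
        gcongr; nlinarith
      _ = _ := by rw [mul_pow, Real.sq_sqrt (hu0 y).le]
  have hss : ∀ y, √(u y) * √(u y) = u y := fun y => Real.mul_self_sqrt (hu0 y).le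
  -- The exponent `k - 1 + 1` differs from `k` only at `k = 0`, where the factor `k` makes the bound
  -- trivial; this avoids a case split.
  have hprod : ∀ (y : E) (b : ℝ), b ≤ A * √(u y) → 0 ≤ b →
      2 * k * u y ^ (k - 1) * (‖a y‖ * b) ≤ 2 * k * ((1 + A * T) * A) * u y ^ (k - 1 + 1) := by
    intro y b hb hb0
    have h3 : ‖a y‖ * b ≤ (1 + A * T) * A * u y := by
      calc ‖a y‖ * b ≤ ((1 + A * T) * √(u y)) * (A * √(u y)) := by gcongr; exact hna y
        _ = (1 + A * T) * A * (√(u y) * √(u y)) := by ring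
        _ = _ := by rw [hss]
    have := (hu0 y).le
    calc 2 * k * u y ^ (k - 1) * (‖a y‖ * b)
        ≤ 2 * k * u y ^ (k - 1) * ((1 + A * T) * A * u y) := by gcongr
      _ = _ := by ring
  -- The part of the expansion linear in the noise is a functional depending on `X` only, applied to
  -- `w` here and to `ν` below, so both contributions have mean zero.
  have hlin₁ := integral_clm_apply_eq_zero hXw hX hNw.integrable hNw.integral_eq_zero
    (V := fun y => (2 * k * u y ^ (k - 1)) • (innerSL ℝ (a y) ∘L γ y))
    (b := fun ω => 2 * k * ((1 + A * T) * A) * u (X ω) ^ (k - 1 + 1))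
    (by
      have h1 : Continuous fun p : E × (F →L[ℝ] E) => innerSL ℝ p.1 ∘L p.2 := by fun_prop
      exact (by fun_prop : Measurable fun y => 2 * (k : ℝ) * u y ^ (k - 1)).smul
        (h1.measurable.comp (ha.prodMk hγ)))
    ((hint (k - 1 + 1)).const_mul _)
    (fun ω => by
      have h0 := (hu0 (X ω)).le
      rw [norm_smul, Real.norm_of_nonneg (by positivity)]
      refine le_trans ?_ (hprod (X ω) _ (hγA (X ω)) (norm_nonneg _))
      gcongr
      exact (ContinuousLinearMap.opNorm_comp_le _ _).trans (by rw [innerSL_apply_norm]))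
  have hlin₂ := integral_clm_apply_eq_zero hXν hX hNν.integrable hNν.integral_eq_zero
    (V := fun y => (2 * k * u y ^ (k - 1) * ⟪a y, κ y⟫) • ContinuousLinearMap.id ℝ ℝ)
    (b := fun ω => 2 * k * ((1 + A * T) * A) * u (X ω) ^ (k - 1 + 1))
    (by
      exact ((by fun_prop : Measurable fun y => 2 * (k : ℝ) * u y ^ (k - 1)).mul
        (ha.inner hκ)).smul_const _)
    ((hint (k - 1 + 1)).const_mul _)
    (fun ω => by
      have h0 := (hu0 (X ω)).le
      rw [norm_smul, ContinuousLinearMap.norm_id, mul_one, norm_mul,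
        Real.norm_of_nonneg (by positivity)]
      refine le_trans ?_ (hprod (X ω) _ (hκA (X ω)) (norm_nonneg _))
      gcongr
      exact abs_real_inner_le_norm _ _)
  have hφm : Measurable fun y => u y ^ k := by fun_prop
  have hφ0 : ∀ y, 0 ≤ u y ^ k := fun y => pow_nonneg (hu0 y).le k
  have hk2 : 2 ≤ 2 * k + 2 := by omega
  obtain ⟨hi1, hl1⟩ := integral_mul_noise_le hXw hNw hφm hφ0 (hint k) le_rfl
  obtain ⟨hi2, hl2⟩ := integral_mul_noise_le hXw hNw hφm hφ0 (hint k) hk2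
  obtain ⟨hi3, hl3⟩ := integral_mul_noise_le hXν hNν hφm hφ0 (hint k) le_rfl
  obtain ⟨hi4, hl4⟩ := integral_mul_noise_le hXν hNν hφm hφ0 (hint k) hk2
  have hpt : ∀ ω, (ρ ^ 2 + ‖a (X ω) + (γ (X ω) (w ω) + ν ω • κ (X ω))‖ ^ 2) ^ k ≤
      u (X ω) ^ k + ((2 * k * u (X ω) ^ (k - 1)) • (innerSL ℝ (a (X ω)) ∘L γ (X ω))) (w ω) +
        ((2 * k * u (X ω) ^ (k - 1) * ⟪a (X ω), κ (X ω)⟫) • ContinuousLinearMap.id ℝ ℝ) (ν ω) +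
        D * (Δ * u (X ω) ^ k + (u (X ω) ^ k * ‖w ω‖ ^ 2 + u (X ω) ^ k * ‖w ω‖ ^ (2 * k + 2)) +
          (u (X ω) ^ k * ‖ν ω‖ ^ 2 + u (X ω) ^ k * ‖ν ω‖ ^ (2 * k + 2))) := by
    intro ω
    have h1 := hstep (a (X ω)) (γ (X ω) (w ω) + ν ω • κ (X ω)) ρ (u (X ω)) Δ ‖w ω‖ ‖ν ω‖
      (hu0 _) hΔ hΔT (norm_nonneg _) (norm_nonneg _) (haA _) (by
        refine (norm_add_le _ _).trans ?_
        rw [mul_add, norm_smul]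
        refine add_le_add (((γ (X ω)).le_opNorm _).trans ?_) ?_
        · gcongr; exact hγA _
        · rw [mul_comm]; gcongr; exact hκA _)
    refine h1.trans (le_of_eq ?_)
    simp only [inner_add_right, inner_smul_right, _root_.smul_apply,
      ContinuousLinearMap.comp_apply, innerSL_apply_apply, smul_eq_mul,
      ContinuousLinearMap.id_apply]
    ring
  have hr1 := (hint k).const_mul Δ
  have h12 := hi1.fun_add hi2
  have h34 := hi3.fun_add hi4
  have hr12 := hr1.fun_add h12
  have hrest := (hr12.fun_add h34).const_mul D
  have hlin := (hint k).fun_add hlin₁.1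
  have hlin' := hlin.fun_add hlin₂.1
  have hdom := hlin'.fun_add hrest
  have hXm : Measurable fun ω => a (X ω) + (γ (X ω) (w ω) + ν ω • κ (X ω)) := by
    have h1 : Continuous fun p : (F →L[ℝ] E) × F => p.1 p.2 := by fun_prop
    have h2 : Measurable fun ω => γ (X ω) (w ω) := h1.measurable.comp ((hγ.comp hX).prodMk hw)
    exact (ha.comp hX).add (h2.add (hν.smul (hκ.comp hX)))
  have hI : Integrable
      (fun ω => (ρ ^ 2 + ‖a (X ω) + (γ (X ω) (w ω) + ν ω • κ (X ω))‖ ^ 2) ^ k) P :=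
    hdom.mono' (((hXm.norm.pow_const 2).const_add _).pow_const k).aestronglyMeasurable (ae_of_all _ fun ω => by
      rw [Real.norm_of_nonneg (by positivity)]
      exact hpt ω)
  refine ⟨hI, (integral_mono hI hdom hpt).trans ?_⟩
  rw [integral_add hlin' hrest, integral_add hlin hlin₂.1, integral_add (hint k) hlin₁.1, hlin₁.2,
    hlin₂.2, integral_const_mul, integral_add hr12 h34, integral_add hr1 h12,
    integral_add hi1 hi2, integral_add hi3 hi4, integral_const_mul]
  set I := ∫ ω, u (X ω) ^ k ∂P with hIdef
  have hI0 : 0 ≤ I := integral_nonneg fun ω => hφ0 _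
  have hQ : ∀ q : ℝ, q * Δ * I ≤ |q| * Δ * I := fun q => by gcongr; exact le_abs_self q
  have hsum := add_le_add (add_le_add (hl1.trans (hQ _)) (hl2.trans (hQ _)))
    (add_le_add (hl3.trans (hQ _)) (hl4.trans (hQ _)))
  have := mul_le_mul_of_nonneg_left hsum hD
  linarith

end OneStep

/-! ### Iteration of the one-step estimate. -/

section Recursion

variable {Ω E F : Type*} {mΩ : MeasurableSpace Ω} {P : Measure Ω}
  [NormedAddCommGroup E] [InnerProductSpace ℝ E]
  [NormedAddCommGroup F] [InnerProductSpace ℝ F] [MeasurableSpace F]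

/-- Two sequences of small noises adapted to a filtration in such a way that the `n`-th noises are
independent of the information available at time `n`. -/
structure IsAdaptedNoise (Q₁ Q₂ : ℕ → ℝ) (Δ : ℝ) (𝒢 : Filtration ℕ mΩ) (w : ℕ → Ω → F)
    (ν : ℕ → Ω → ℝ) (P : Measure Ω) : Prop where
  measurable_left : ∀ n, Measurable[𝒢 (n + 1)] (w n)
  measurable_right : ∀ n, Measurable[𝒢 (n + 1)] (ν n)
  indep_left : ∀ n, Indep (MeasurableSpace.comap (w n) inferInstance) (𝒢 n) P
  indep_right : ∀ n, Indep (MeasurableSpace.comap (ν n) inferInstance) (𝒢 n) P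
  small_left : ∀ n, IsSmallNoise Q₁ Δ (w n) P
  small_right : ∀ n, IsSmallNoise Q₂ Δ (ν n) P

/-- The recursion `X (n + 1) = a (X n) + γ (X n) (w n) + ν n • κ (X n)`. -/
def noisyRecursion (a κ : E → E) (γ : E → F →L[ℝ] E) (X₀ : Ω → E) (w : ℕ → Ω → F)
    (ν : ℕ → Ω → ℝ) : ℕ → Ω → E
  | 0 => X₀
  | n + 1 => fun ω => a (noisyRecursion a κ γ X₀ w ν n ω) +
      (γ (noisyRecursion a κ γ X₀ w ν n ω) (w n ω) + ν n ω • κ (noisyRecursion a κ γ X₀ w ν n ω))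

variable [FiniteDimensional ℝ E] [MeasurableSpace E] [BorelSpace E] [FiniteDimensional ℝ F]
  [BorelSpace F]

/-- Measurability with respect to `𝒢 n`, not merely the ambient σ-algebra, is what makes the current
value independent of the next noises. -/
lemma measurable_noisyRecursion {Q₁ Q₂ : ℕ → ℝ} {Δ : ℝ} {𝒢 : Filtration ℕ mΩ} {w : ℕ → Ω → F}
    {ν : ℕ → Ω → ℝ} (hN : IsAdaptedNoise Q₁ Q₂ Δ 𝒢 w ν P) {a κ : E → E} {γ : E → F →L[ℝ] E}
    (ha : Measurable a) (hκ : Measurable κ) (hγ : Measurable γ) {X₀ : Ω → E}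
    (hX₀ : Measurable[𝒢 0] X₀) (n : ℕ) : Measurable[𝒢 n] (noisyRecursion a κ γ X₀ w ν n) := by
  have : ProperSpace E := FiniteDimensional.proper ℝ _
  have : ProperSpace F := FiniteDimensional.proper ℝ _
  induction n with
  | zero => exact hX₀
  | succ n ih =>
    have hX := ih.mono (𝒢.mono n.le_succ) le_rfl
    have h1 : Continuous fun p : (F →L[ℝ] E) × F => p.1 p.2 := by fun_prop
    have h2 := h1.measurable.comp ((hγ.comp hX).prodMk (hN.measurable_left n))
    exact (ha.comp hX).add (h2.add ((hN.measurable_right n).smul (hκ.comp hX)))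

/-- Moment bound for a recursion driven by small noises, uniform in the step size. -/
lemma exists_integral_pow_noisyRecursion_le [IsProbabilityMeasure P] {A T : ℝ} (hA : 0 ≤ A)
    (hT : 0 ≤ T) (Q₁ Q₂ : ℕ → ℝ) (k : ℕ) :
    ∃ C : ℝ, 0 ≤ C ∧ ∀ (𝒢 : Filtration ℕ mΩ) (X₀ : Ω → E) (w : ℕ → Ω → F) (ν : ℕ → Ω → ℝ)
      (a κ : E → E) (γ : E → F →L[ℝ] E) (ρ Δ : ℝ) (M : ℕ), 1 ≤ ρ → 0 ≤ Δ → Δ ≤ T → M * Δ ≤ T →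
      Measurable a → Measurable κ → Measurable γ → IsAdaptedNoise Q₁ Q₂ Δ 𝒢 w ν P →
      Measurable[𝒢 0] X₀ →
      (∀ y, ρ ^ 2 + ‖a y‖ ^ 2 ≤ (1 + A * Δ) * (ρ ^ 2 + ‖y‖ ^ 2)) →
      (∀ y, ‖γ y‖ ≤ A * √(ρ ^ 2 + ‖y‖ ^ 2)) → (∀ y, ‖κ y‖ ≤ A * √(ρ ^ 2 + ‖y‖ ^ 2)) →
      (∀ j : ℕ, Integrable (fun ω => (ρ ^ 2 + ‖X₀ ω‖ ^ 2) ^ j) P) → ∀ n ≤ M,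
      Integrable (fun ω => (ρ ^ 2 + ‖noisyRecursion a κ γ X₀ w ν n ω‖ ^ 2) ^ k) P ∧
      ∫ ω, (ρ ^ 2 + ‖noisyRecursion a κ γ X₀ w ν n ω‖ ^ 2) ^ k ∂P ≤
        C * ∫ ω, (ρ ^ 2 + ‖X₀ ω‖ ^ 2) ^ k ∂P := by
  obtain ⟨C, hC, hstep⟩ := exists_integral_pow_step_le (P := P) (E := E) (F := F) hA hT Q₁ Q₂ k
  refine ⟨Real.exp (C * T), (Real.exp_pos _).le, ?_⟩
  intro 𝒢 X₀ w ν a κ γ ρ Δ M hρ hΔ hΔT hM ha hκ hγ hN hX₀ haA hγA hκA hint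
  have hmeas := measurable_noisyRecursion hN ha hκ hγ hX₀
  have hm n := (hmeas n).mono (𝒢.le n) le_rfl
  have hw n := (hN.measurable_left n).mono (𝒢.le (n + 1)) le_rfl
  have hν n := (hN.measurable_right n).mono (𝒢.le (n + 1)) le_rfl
  have hind₁ n : IndepFun (noisyRecursion a κ γ X₀ w ν n) (w n) P :=
    (indep_of_indep_of_le_right (hN.indep_left n) (hmeas n).comap_le).symm
  have hind₂ n : IndepFun (noisyRecursion a κ γ X₀ w ν n) (ν n) P :=
    (indep_of_indep_of_le_right (hN.indep_right n) (hmeas n).comap_le).symm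
  -- The one-step estimate requires integrability of every power, so all powers are propagated
  -- together; the constants for the various `j` are discarded.
  have hall : ∀ n, ∀ j : ℕ,
      Integrable (fun ω => (ρ ^ 2 + ‖noisyRecursion a κ γ X₀ w ν n ω‖ ^ 2) ^ j) P := by
    intro n
    induction n with
    | zero => exact hint
    | succ n ih =>
      intro j
      obtain ⟨_, _, hj⟩ := exists_integral_pow_step_le (P := P) (E := E) (F := F) hA hT Q₁ Q₂ j
      exact (hj _ _ _ a κ γ ρ Δ hρ hΔ hΔT (hm n) (hw n) (hν n) ha hκ hγ (hind₁ n) (hind₂ n)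
        (hN.small_left n) (hN.small_right n) haA hγA hκA ih).1
  have hI0 : 0 ≤ ∫ ω, (ρ ^ 2 + ‖X₀ ω‖ ^ 2) ^ k ∂P := integral_nonneg fun _ => by positivity
  have hpow : ∀ n, ∫ ω, (ρ ^ 2 + ‖noisyRecursion a κ γ X₀ w ν n ω‖ ^ 2) ^ k ∂P ≤
      (1 + C * Δ) ^ n * ∫ ω, (ρ ^ 2 + ‖X₀ ω‖ ^ 2) ^ k ∂P := by
    intro n
    induction n with
    | zero => simp [noisyRecursion]
    | succ n ih =>
      refine (hstep _ _ _ a κ γ ρ Δ hρ hΔ hΔT (hm n) (hw n) (hν n) ha hκ hγ (hind₁ n) (hind₂ n)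
        (hN.small_left n) (hN.small_right n) haA hγA hκA (hall n)).2.trans ?_
      rw [pow_succ' (1 + C * Δ), mul_assoc]
      gcongr
  refine fun n hn => ⟨hall n k, (hpow n).trans ?_⟩
  gcongr
  calc (1 + C * Δ) ^ n ≤ Real.exp (C * Δ) ^ n := by
        gcongr
        linarith [Real.add_one_le_exp (C * Δ)]
    _ = Real.exp (C * (n * Δ)) := by rw [← Real.exp_nat_mul]; congr 1; ring
    _ ≤ Real.exp (C * T) := by
        gcongr
        exact le_trans (by gcongr) hM

end Recursion

/-! ### The tamed scheme and its frozen version. -/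

section Tamed

variable {E : Type*} [NormedAddCommGroup E] [InnerProductSpace ℝ E]

/-- One step of the tamed Euler scheme without noise. -/
noncomputable def tamedStep (b : E → E) (Δ : ℝ) (y : E) : E :=
  y + (Δ / (1 + Δ * ‖b y‖)) • b y

lemma norm_tamedStep_le (b : E → E) {Δ : ℝ} (hΔ : 0 ≤ Δ) (y : E) :
    ‖tamedStep b Δ y‖ ≤ ‖y‖ + 1 := by
  refine (norm_add_le _ _).trans ?_
  gcongr
  rw [norm_smul, Real.norm_of_nonneg (by positivity), div_mul_eq_mul_div,
    div_le_one (by positivity)]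
  linarith

/-- A displacement of length at most `1` adds at most `2 * ‖y‖ + 1` to the square, and `(2 * ‖y‖ +
1) * ρ ≤ 2 * (ρ ^ 2 + ‖y‖ ^ 2)`. For `ρ` equal to the number of steps the factor is `1 + O(Δ)`, with
no condition on `b`. -/
lemma sq_add_norm_tamedStep_sq_le (b : E → E) {Δ ρ : ℝ} (hΔ : 0 ≤ Δ) (hρ : 1 ≤ ρ) (y : E) :
    ρ ^ 2 + ‖tamedStep b Δ y‖ ^ 2 ≤ (1 + 2 / ρ) * (ρ ^ 2 + ‖y‖ ^ 2) := by
  have h1 : ‖tamedStep b Δ y‖ ^ 2 ≤ (‖y‖ + 1) ^ 2 := by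
    gcongr; exact norm_tamedStep_le b hΔ y
  have hρ0 : 0 < ρ := by linarith
  have h2 : 2 * ‖y‖ + 1 ≤ 2 / ρ * (ρ ^ 2 + ‖y‖ ^ 2) := by
    rw [div_mul_eq_mul_div, le_div_iff₀ hρ0]
    nlinarith [sq_nonneg (ρ - ‖y‖), sq_nonneg ‖y‖]
  nlinarith

/-- The taming only shortens the step, from `Δ` to `c ≤ Δ`. The cross term is controlled by the
one-sided bound and the square `c ^ 2 * ‖b y‖ ^ 2` by `hy`. -/
lemma one_add_norm_tamedStep_sq_le {b : E → E} {A Δ : ℝ} (hA : 0 ≤ A) (hΔ : 0 ≤ Δ) {y : E}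
    (hb : ⟪y, b y⟫ ≤ A * (1 + ‖y‖ ^ 2)) (hy : Δ * ‖b y‖ ^ 2 ≤ 1 + ‖y‖ ^ 2) :
    1 + ‖tamedStep b Δ y‖ ^ 2 ≤ (1 + (2 * A + 1) * Δ) * (1 + ‖y‖ ^ 2) := by
  set c := Δ / (1 + Δ * ‖b y‖) with hc
  have hc0 : 0 ≤ c := by positivity
  have hcΔ : c ≤ Δ := div_le_self hΔ (by nlinarith [mul_nonneg hΔ (norm_nonneg (b y))])
  have h1 : c * ⟪y, b y⟫ ≤ Δ * (A * (1 + ‖y‖ ^ 2)) :=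
    (mul_le_mul_of_nonneg_left hb hc0).trans (by gcongr)
  have h2 : c ^ 2 * ‖b y‖ ^ 2 ≤ Δ * (1 + ‖y‖ ^ 2) := by
    calc c ^ 2 * ‖b y‖ ^ 2 ≤ Δ ^ 2 * ‖b y‖ ^ 2 := by gcongr
      _ = Δ * (Δ * ‖b y‖ ^ 2) := by ring
      _ ≤ _ := by gcongr
  rw [tamedStep, norm_add_sq_real, inner_smul_right, norm_smul, mul_pow, Real.norm_eq_abs, sq_abs]
  linarith

variable {Ω F : Type*} {mΩ : MeasurableSpace Ω} {P : Measure Ω} [IsProbabilityMeasure P]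
  [NormedAddCommGroup F] [InnerProductSpace ℝ F] [MeasurableSpace F]
  [FiniteDimensional ℝ E] [MeasurableSpace E] [BorelSpace E] [FiniteDimensional ℝ F]
  [BorelSpace F]

open Classical in
/-- Uniform moment bound for the tamed Euler scheme. The scheme is compared with the one that is
frozen when it leaves the region in which the taming is inactive; the probability of leaving that
region beats the polynomial growth in the number of steps of the moments of the scheme. -/
theorem exists_integral_pow_tamed_le {A T : ℝ} (hA : 0 ≤ A) (hT : 0 < T) (Q₁ Q₂ : ℕ → ℝ)
    {b κ : E → E} {γ : E → F →L[ℝ] E} (hbm : Measurable b) (hκm : Measurable κ)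
    (hγm : Measurable γ) (q : ℕ) (hb : ∀ y, ⟪y, b y⟫ ≤ A * (1 + ‖y‖ ^ 2))
    (hbq : ∀ y, ‖b y‖ ^ 2 ≤ A * (1 + ‖y‖ ^ 2) ^ q)
    (hγ : ∀ y, ‖γ y‖ ≤ A * √(1 + ‖y‖ ^ 2)) (hκ : ∀ y, ‖κ y‖ ≤ A * √(1 + ‖y‖ ^ 2))
    {X₀ : Ω → E} (hX₀ : ∀ j : ℕ, Integrable (fun ω => (1 + ‖X₀ ω‖ ^ 2) ^ j) P) (k : ℕ) :
    ∃ C : ℝ, 0 ≤ C ∧ ∀ (M : ℕ) (𝒢 : Filtration ℕ mΩ) (w : ℕ → Ω → F) (ν : ℕ → Ω → ℝ), 1 ≤ M →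
      Measurable[𝒢 0] X₀ → IsAdaptedNoise Q₁ Q₂ (T / M) 𝒢 w ν P → ∀ n ≤ M,
      Integrable (fun ω =>
        (1 + ‖noisyRecursion (tamedStep b (T / M)) κ γ X₀ w ν n ω‖ ^ 2) ^ k) P ∧
      ∫ ω, (1 + ‖noisyRecursion (tamedStep b (T / M)) κ γ X₀ w ν n ω‖ ^ 2) ^ k ∂P ≤ C := by
  -- `2 * A + 1` is the growth rate in the good region; `2 / T` turns the crude factor `1 + 2 / M`
  -- into `1 + (2 / T) * Δ`.
  set A' := 2 * A + 1 + 2 / T with hA'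
  have hA'0 : 0 ≤ A' := by positivity
  have hAA' : A ≤ A' := by have : 0 < 2 / T := by positivity
                           linarith
  have h2T : 2 / T ≤ A' := by linarith
  have h2A : 2 * A + 1 ≤ A' := by have : 0 < 2 / T := by positivity
                                  linarith
  have hbound i := exists_integral_pow_noisyRecursion_le (P := P) (E := E) (F := F)
    hA'0 hT.le Q₁ Q₂ i
  choose c hc0 hc using hbound
  set m : ℕ → ℝ := fun j => ∫ ω, (1 + ‖X₀ ω‖ ^ 2) ^ j ∂P with hm
  have hm0 j : 0 ≤ m j := integral_nonneg fun _ => by positivity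
  refine ⟨c k * m k + (T * A) ^ (4 * k) * (c (q * (4 * k)) * m (q * (4 * k))) +
    c (2 * k) * m (2 * k), by
      have := hm0 k; have := hm0 (q * (4 * k)); have := hm0 (2 * k)
      have := hc0 k; have := hc0 (q * (4 * k)); have := hc0 (2 * k)
      positivity, ?_⟩
  intro M 𝒢 w ν hM hX₀m hN n hn
  have hM1 : (1 : ℝ) ≤ M := by exact_mod_cast hM
  have hM0 : (0 : ℝ) < M := by linarith
  set Δ := T / M with hΔ
  have hΔ0 : 0 ≤ Δ := by positivity
  have hΔT : Δ ≤ T := div_le_self hT.le hM1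
  have hMΔ : M * Δ ≤ T := by rw [hΔ]; field_simp; exact le_rfl
  have ham : Measurable (tamedStep b Δ) := by
    have : ProperSpace E := FiniteDimensional.proper ℝ _
    unfold tamedStep; fun_prop
  set Y := noisyRecursion (tamedStep b Δ) κ γ X₀ w ν with hY
  set G : Set E := {y | Δ * ‖b y‖ ^ 2 ≤ 1 + ‖y‖ ^ 2} with hG
  have hGm : MeasurableSet G := measurableSet_le (by fun_prop) (by fun_prop)
  set aG : E → E := fun y => if y ∈ G then tamedStep b Δ y else y with haG
  set κG : E → E := fun y => if y ∈ G then κ y else 0 with hκG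
  set γG : E → F →L[ℝ] E := fun y => if y ∈ G then γ y else 0 with hγG
  set Z := noisyRecursion aG κG γG X₀ w ν with hZ
  -- Outside `G` the frozen scheme no longer moves, so a path of `Z` found in `G` at time `n` has
  -- been there at all earlier times and has followed `Y`.
  have hYZ : ∀ n ω, Z n ω ∈ G → Y n ω = Z n ω := by
    intro n ω
    induction n with
    | zero => intro _; rfl
    | succ n ih =>
      have hYs : Y (n + 1) ω = tamedStep b Δ (Y n ω) + (γ (Y n ω) (w n ω) + ν n ω • κ (Y n ω)) :=
        rfl
      have hZs : Z (n + 1) ω = aG (Z n ω) + (γG (Z n ω) (w n ω) + ν n ω • κG (Z n ω)) := rfl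
      intro hmem
      by_cases hz : Z n ω ∈ G
      · rw [hYs, hZs, ih hz]
        simp only [haG, hκG, hγG, if_pos hz]
      · simp only [haG, hκG, hγG, if_neg hz, zero_apply, smul_zero,
          add_zero] at hZs
        rw [hZs] at hmem
        exact absurd hmem hz
  have hu1 : ∀ y : E, 1 ≤ 1 + ‖y‖ ^ 2 := fun y => by nlinarith [sq_nonneg ‖y‖]
  have hZb : ∀ i, Integrable (fun ω => (1 + ‖Z n ω‖ ^ 2) ^ i) P ∧
      ∫ ω, (1 + ‖Z n ω‖ ^ 2) ^ i ∂P ≤ c i * m i := by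
    intro i
    have h := hc i 𝒢 X₀ w ν aG κG γG 1 Δ M le_rfl hΔ0 hΔT hMΔ
      (Measurable.ite hGm ham measurable_id) (Measurable.ite hGm hκm measurable_const)
      (Measurable.ite hGm hγm measurable_const) hN hX₀m
    simp only [one_pow] at h
    refine h ?_ ?_ ?_ hX₀ n hn
    · intro y
      by_cases hy : y ∈ G
      · simp only [haG, if_pos hy]
        refine (one_add_norm_tamedStep_sq_le hA hΔ0 (hb y) hy).trans ?_
        gcongr
      · simp only [haG, if_neg hy]
        have : 0 ≤ A' * Δ := by positivity
        nlinarith [hu1 y]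
    · intro y
      by_cases hy : y ∈ G
      · simp only [hγG, if_pos hy]
        exact (hγ y).trans (by gcongr)
      · simp only [hγG, if_neg hy, norm_zero]
        positivity
    · intro y
      by_cases hy : y ∈ G
      · simp only [hκG, if_pos hy]
        exact (hκ y).trans (by gcongr)
      · simp only [hκG, if_neg hy, norm_zero]
        positivity
  have hM2 : (1 : ℝ) ≤ (M : ℝ) ^ 2 := one_le_pow₀ hM1
  have hX₀M : ∀ (j : ℕ) ω, ((M : ℝ) ^ 2 + ‖X₀ ω‖ ^ 2) ^ j ≤
      (M : ℝ) ^ (2 * j) * (1 + ‖X₀ ω‖ ^ 2) ^ j := by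
    intro j ω
    rw [pow_mul, ← mul_pow]
    gcongr
    nlinarith [sq_nonneg ‖X₀ ω‖]
  have hX₀m' : Measurable X₀ := hX₀m.mono (𝒢.le 0) le_rfl
  have hX₀Mi : ∀ j : ℕ, Integrable (fun ω => ((M : ℝ) ^ 2 + ‖X₀ ω‖ ^ 2) ^ j) P := fun j =>
    ((hX₀ j).const_mul ((M : ℝ) ^ (2 * j))).mono' (by fun_prop) (ae_of_all _ fun ω => by
      rw [Real.norm_of_nonneg (by positivity)]; exact hX₀M j ω)
  -- The crude bound, with `ρ = M`. The power is `2 * k` because Young's inequality below squares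
  -- the `k`-th power.
  obtain ⟨hYi, hYb⟩ := hc (2 * k) 𝒢 X₀ w ν (tamedStep b Δ) κ γ M Δ M hM1 hΔ0 hΔT hMΔ ham hκm hγm
    hN hX₀m
    (fun y => by
      refine (sq_add_norm_tamedStep_sq_le b hΔ0 hM1 y).trans ?_
      gcongr
      calc 2 / (M : ℝ) = 2 / T * Δ := by rw [hΔ]; field_simp
        _ ≤ A' * Δ := by gcongr)
    (fun y => (hγ y).trans (by gcongr)) (fun y => (hκ y).trans (by gcongr)) hX₀Mi n hn
  rw [← hY] at hYi hYb
  have hpt : ∀ ω, (1 + ‖Y n ω‖ ^ 2) ^ k ≤ (1 + ‖Z n ω‖ ^ 2) ^ k +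
      (T * A) ^ (4 * k) * (1 + ‖Z n ω‖ ^ 2) ^ (q * (4 * k)) +
      ((M : ℝ) ^ (4 * k))⁻¹ * ((M : ℝ) ^ 2 + ‖Y n ω‖ ^ 2) ^ (2 * k) := by
    intro ω
    have hz0 := zero_le_one.trans (hu1 (Z n ω))
    by_cases hz : Z n ω ∈ G
    · rw [hYZ n ω hz, add_assoc]
      exact le_add_of_nonneg_right (by positivity)
    -- Off the good region `M ≤ s`, with `s` a polynomial in `‖Z n ω‖`. Hence `(1 + ‖Y‖ ^ 2) ^ k = M
    -- ^ (2 * k) * x ≤ s ^ (2 * k) * x ≤ s ^ (4 * k) + x ^ 2`, where `x` is normalised so that `x ^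
    -- 2` has mean bounded uniformly in `M`.
    · have h1 : 1 ≤ Δ * (A * (1 + ‖Z n ω‖ ^ 2) ^ q) := by
        have h2 : 1 + ‖Z n ω‖ ^ 2 < Δ * ‖b (Z n ω)‖ ^ 2 := not_le.1 hz
        have h3 : Δ * ‖b (Z n ω)‖ ^ 2 ≤ Δ * (A * (1 + ‖Z n ω‖ ^ 2) ^ q) := by
          gcongr; exact hbq _
        linarith [hu1 (Z n ω)]
      set s := T * (A * (1 + ‖Z n ω‖ ^ 2) ^ q) with hs
      have hs1 : (M : ℝ) ≤ s := by
        rw [hΔ, div_mul_eq_mul_div, le_div_iff₀ hM0, one_mul] at h1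
        exact h1
      set x := ((M : ℝ) ^ (2 * k))⁻¹ * (1 + ‖Y n ω‖ ^ 2) ^ k with hx
      have hx0 : 0 ≤ x := by positivity
      have hp : (0 : ℝ) < (M : ℝ) ^ (2 * k) := by positivity
      have h4 : (1 + ‖Y n ω‖ ^ 2) ^ k ≤ s ^ (2 * k) * x := by
        calc (1 + ‖Y n ω‖ ^ 2) ^ k = (M : ℝ) ^ (2 * k) * x := by rw [hx]; field_simp
          _ ≤ s ^ (2 * k) * x := by gcongr
      have h5 : s ^ (2 * k) * x ≤ (s ^ (2 * k)) ^ 2 + x ^ 2 := by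
        nlinarith [sq_nonneg (s ^ (2 * k) - x), sq_nonneg (s ^ (2 * k)), sq_nonneg x]
      have h6 : (s ^ (2 * k)) ^ 2 = (T * A) ^ (4 * k) * (1 + ‖Z n ω‖ ^ 2) ^ (q * (4 * k)) := by
        rw [hs, ← pow_mul, ← mul_assoc, mul_pow, pow_mul _ q (4 * k),
          show 2 * k * 2 = 4 * k by ring]
      have h7 : x ^ 2 ≤ ((M : ℝ) ^ (4 * k))⁻¹ * ((M : ℝ) ^ 2 + ‖Y n ω‖ ^ 2) ^ (2 * k) := by
        rw [hx, mul_pow, ← pow_mul, inv_pow, ← pow_mul, show 2 * k * 2 = 4 * k by ring,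
          mul_comm k 2]
        gcongr
      have h8 : 0 ≤ (1 + ‖Z n ω‖ ^ 2) ^ k := by positivity
      linarith
  have hi2 := (hZb (q * (4 * k))).1.const_mul ((T * A) ^ (4 * k))
  have hi3 := hYi.const_mul ((M : ℝ) ^ (4 * k))⁻¹
  have hi12 := (hZb k).1.fun_add hi2
  have hdom := hi12.fun_add hi3
  have hYm : Measurable (Y n) :=
    (measurable_noisyRecursion hN ham hκm hγm hX₀m n).mono (𝒢.le n) le_rfl
  have hI : Integrable (fun ω => (1 + ‖Y n ω‖ ^ 2) ^ k) P :=
    hdom.mono' (by fun_prop) (ae_of_all _ fun ω => by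
      rw [Real.norm_of_nonneg (by positivity)]; exact hpt ω)
  refine ⟨hI, (integral_mono hI hdom hpt).trans ?_⟩
  rw [integral_add hi12 hi3, integral_add (hZb k).1 hi2, integral_const_mul, integral_const_mul]
  refine add_le_add (add_le_add (hZb k).2 ?_) ?_
  · gcongr
    exact (hZb _).2
  -- The growth `M ^ (4 * k)` of the crude moment cancels against the prefactor.
  · rw [inv_mul_le_iff₀ (by positivity)]
    refine hYb.trans ?_
    have h9 : ∫ ω, ((M : ℝ) ^ 2 + ‖X₀ ω‖ ^ 2) ^ (2 * k) ∂P ≤ (M : ℝ) ^ (4 * k) * m (2 * k) := by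
      rw [hm, ← integral_const_mul]
      refine integral_mono (hX₀Mi _) ((hX₀ _).const_mul _) fun ω => ?_
      have := hX₀M (2 * k) ω
      rwa [show 2 * (2 * k) = 4 * k by ring] at this
    have := mul_le_mul_of_nonneg_left h9 (hc0 (2 * k))
    linarith

end Tamed

/-! ### Growth of the coefficients. -/

lemma norm_le_sqrt_one_add_sq {E : Type*} [NormedAddCommGroup E] (y : E) :
    ‖y‖ ≤ √(1 + ‖y‖ ^ 2) :=
  Real.le_sqrt_of_sq_le (by linarith)

lemma one_le_sqrt_one_add_sq (x : ℝ) : 1 ≤ √(1 + x ^ 2) :=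
  Real.le_sqrt_of_sq_le (by nlinarith [sq_nonneg x])

/-- A Lipschitz map has linear growth. -/
lemma norm_le_mul_sqrt_of_lipschitz {E G : Type*} [NormedAddCommGroup E] [NormedAddCommGroup G]
    {φ : E → G} {C : ℝ} (hC : 0 ≤ C) (hφ : ∀ x y, ‖φ x - φ y‖ ≤ C * ‖x - y‖) (y : E) :
    ‖φ y‖ ≤ (‖φ 0‖ + C) * √(1 + ‖y‖ ^ 2) := by
  have h1 : ‖φ y‖ ≤ ‖φ 0‖ + C * ‖y‖ := by
    have h2 := hφ y 0
    rw [sub_zero] at h2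
    linarith [norm_le_norm_add_norm_sub' (φ y) (φ 0)]
  have h3 := mul_le_mul_of_nonneg_left (one_le_sqrt_one_add_sq ‖y‖) (norm_nonneg (φ 0))
  have h4 := mul_le_mul_of_nonneg_left (norm_le_sqrt_one_add_sq y) hC
  linarith

section Drift

variable {E : Type*} [NormedAddCommGroup E] [InnerProductSpace ℝ E] {f h : E → E} {C H : ℝ}

lemma inner_compensatedDrift_le (lam : ℝ≥0) (hC : 0 ≤ C)
    (hf : ∀ x y, ⟪x - y, f x - f y⟫ ≤ C * ‖x - y‖ ^ 2)
    (hh : ∀ y, ‖h y‖ ≤ H * √(1 + ‖y‖ ^ 2)) (y : E) :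
    ⟪y, compensatedDrift f h lam y⟫ ≤ (C + ‖f 0‖ + lam * H) * (1 + ‖y‖ ^ 2) := by
  set s := √(1 + ‖y‖ ^ 2) with hs
  have hss : s * s = 1 + ‖y‖ ^ 2 := Real.mul_self_sqrt (by positivity)
  have hys : ‖y‖ ≤ s := norm_le_sqrt_one_add_sq y
  have hs1 : 1 ≤ s := one_le_sqrt_one_add_sq _
  have h1 := hf y 0
  rw [sub_zero, inner_sub_right] at h1
  have h2 : ⟪y, f 0⟫ ≤ ‖f 0‖ * (s * s) := by
    calc ⟪y, f 0⟫ ≤ ‖y‖ * ‖f 0‖ := real_inner_le_norm _ _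
      _ ≤ (s * s) * ‖f 0‖ := by gcongr; nlinarith
      _ = _ := mul_comm _ _
  have h3 : (lam : ℝ) * ⟪y, h y⟫ ≤ lam * (H * (s * s)) := by
    gcongr
    calc ⟪y, h y⟫ ≤ ‖y‖ * ‖h y‖ := real_inner_le_norm _ _
      _ ≤ s * (H * s) := by gcongr; exact hh y
      _ = _ := by ring
  have h4 : C * ‖y‖ ^ 2 ≤ C * (s * s) := by rw [hss]; gcongr; linarith
  rw [compensatedDrift, inner_add_right, inner_smul_right, ← hss]
  linarith

lemma norm_compensatedDrift_sq_le (lam : ℝ≥0) {K c : ℝ} (hC : 0 ≤ C) (hK : 0 ≤ K) (hc : 0 < c)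
    (hH : 0 ≤ H) (hf : ∀ x y, ‖f x - f y‖ ≤ C * (K + ‖x‖ ^ c + ‖y‖ ^ c) * ‖x - y‖)
    (hh : ∀ y, ‖h y‖ ≤ H * √(1 + ‖y‖ ^ 2)) (y : E) :
    ‖compensatedDrift f h lam y‖ ^ 2 ≤
      (‖f 0‖ + C * (K + 1) + lam * H) ^ 2 * (1 + ‖y‖ ^ 2) ^ (⌈c⌉₊ + 1) := by
  set s := √(1 + ‖y‖ ^ 2) with hs
  set N := ⌈c⌉₊ with hN
  have hss : s ^ 2 = 1 + ‖y‖ ^ 2 := Real.sq_sqrt (by positivity)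
  have hys : ‖y‖ ≤ s := norm_le_sqrt_one_add_sq y
  have hs1 : 1 ≤ s := one_le_sqrt_one_add_sq _
  have hs0 : 0 ≤ s := by linarith
  have hsN : 1 ≤ s ^ N := one_le_pow₀ hs1
  -- Passing to `s ≥ 1` allows the real exponent `c` to be raised to its integer ceiling.
  have hyc : ‖y‖ ^ c ≤ s ^ N := by
    calc ‖y‖ ^ c ≤ s ^ c := by gcongr
      _ ≤ s ^ (N : ℝ) := Real.rpow_le_rpow_of_exponent_le hs1 (Nat.le_ceil c)
      _ = s ^ N := Real.rpow_natCast _ _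
  have h1 : ‖f y‖ ≤ (‖f 0‖ + C * (K + 1)) * s ^ (N + 1) := by
    have h2 := hf y 0
    rw [sub_zero, norm_zero, Real.zero_rpow hc.ne', add_zero] at h2
    have h3 : C * (K + ‖y‖ ^ c) * ‖y‖ ≤ C * (K * s ^ N + s ^ N) * s := by
      gcongr
      exact le_mul_of_one_le_right hK hsN
    have h4 : ‖f 0‖ ≤ ‖f 0‖ * s ^ (N + 1) :=
      le_mul_of_one_le_right (norm_nonneg _) (one_le_pow₀ hs1)
    calc ‖f y‖ ≤ ‖f 0‖ + ‖f y - f 0‖ := norm_le_norm_add_norm_sub' _ _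
      _ ≤ ‖f 0‖ * s ^ (N + 1) + C * (K * s ^ N + s ^ N) * s := add_le_add h4 (h2.trans h3)
      _ = _ := by ring
  have h5 : (lam : ℝ) * ‖h y‖ ≤ lam * (H * s ^ (N + 1)) := by
    gcongr
    refine (hh y).trans ?_
    gcongr
    exact le_self_pow₀ hs1 (Nat.succ_ne_zero N)
  have h6 : ‖compensatedDrift f h lam y‖ ≤ (‖f 0‖ + C * (K + 1) + lam * H) * s ^ (N + 1) := by
    refine (norm_add_le _ _).trans ?_
    rw [norm_smul, NNReal.norm_eq]
    linarith
  calc ‖compensatedDrift f h lam y‖ ^ 2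
      ≤ ((‖f 0‖ + C * (K + 1) + lam * H) * s ^ (N + 1)) ^ 2 := by gcongr
    _ = _ := by rw [mul_pow, ← pow_mul, mul_comm (N + 1) 2, pow_mul, hss]

end Drift

/-! ### Reduction of the scheme to the abstract recursion. -/

lemma gridTime_succ (T : ℝ≥0) (M n : ℕ) : gridTime T M (n + 1) = gridTime T M n + T / M := by
  simp only [gridTime]; push_cast; ring

lemma gridTime_mono (T : ℝ≥0) (M : ℕ) : Monotone (gridTime T M) := fun i j hij => by
  simp only [gridTime]; gcongr

section Scheme

variable {Ω : Type*} {mΩ : MeasurableSpace Ω} {P : Measure Ω}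

/-- The increments of a Brownian motion and of a compensated Poisson process along a regular
grid. -/
lemma exists_isAdaptedNoise_increments {m : ℕ} {ℱ : Filtration ℝ≥0 mΩ}
    {W : ℝ≥0 → Ω → EuclideanSpace ℝ (Fin m)} (hW : IsFilteredBrownianMotion W ℱ P) {lam : ℝ≥0}
    {N : ℝ≥0 → Ω → ℕ} (hN : IsFilteredPoissonProcess N lam ℱ P) (T : ℝ≥0) :
    ∃ Q₁ Q₂ : ℕ → ℝ, ∀ M : ℕ, 1 ≤ M → ∃ 𝒢 : Filtration ℕ mΩ, 𝒢 0 = ℱ 0 ∧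
      IsAdaptedNoise Q₁ Q₂ ((T : ℝ) / M) 𝒢
        (fun n ω => W (gridTime T M (n + 1)) ω - W (gridTime T M n) ω)
        (fun n ω => compensated N lam (gridTime T M (n + 1)) ω -
          compensated N lam (gridTime T M n) ω) P := by
  -- The moment bounds depend on `T`, `lam` and `m` but not on `M`, and `𝒢` samples `ℱ` at the grid
  -- points.
  refine ⟨fun j => √(T : ℝ) ^ (j - 2) *
      ∫ z, ‖z‖ ^ j ∂(stdGaussian (EuclideanSpace ℝ (Fin m))),
    fun j => 2 ^ j * (j.factorial * ((Real.exp 1 - 1) *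
      Real.exp (lam * T * (Real.exp 1 - 1))) + (lam * T) ^ (j - 1)) * lam,
    fun M hM => ⟨⟨fun n => ℱ (gridTime T M n), fun i j hij =>
    ℱ.mono (gridTime_mono T M hij), fun n => ℱ.le _⟩, by simp [gridTime], ?_⟩⟩
  have hle n : gridTime T M n ≤ gridTime T M (n + 1) := gridTime_mono T M n.le_succ
  have hδ : ((T / M : ℝ≥0) : ℝ) = (T : ℝ) / M := by push_cast; rfl
  have hδT : (T : ℝ) / M ≤ T := div_le_self T.coe_nonneg (by exact_mod_cast hM)
  have hν n : (fun ω => compensated N lam (gridTime T M (n + 1)) ω -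
      compensated N lam (gridTime T M n) ω) =
      fun ω => ((N (gridTime T M (n + 1)) ω : ℝ) - N (gridTime T M n) ω) -
        lam * ((T / M : ℝ≥0) : ℝ) := by
    ext ω
    simp only [compensated, gridTime_succ, NNReal.coe_add]
    ring
  have hNm n : Measurable[ℱ (gridTime T M (n + 1))]
      fun ω => (N (gridTime T M (n + 1)) ω : ℝ) - N (gridTime T M n) ω := by
    have hc : Measurable (Nat.cast : ℕ → ℝ) := by fun_prop
    exact (hc.comp (hN.adapted _)).sub
      (hc.comp ((hN.adapted _).mono (ℱ.mono (hle n)) le_rfl))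
  constructor
  · exact fun n => (hW.adapted _).sub ((hW.adapted _).mono (ℱ.mono (hle n)) le_rfl)
  · intro n
    rw [hν]
    exact (hNm n).sub_const _
  · exact fun n => hW.indep_increment _ _ (hle n)
  · intro n
    rw [hν]
    refine indep_of_indep_of_le_left (hN.indep_increment _ _ (hle n)) ?_
    have h1 : Measurable fun x : ℝ => x - lam * ((T / M : ℝ≥0) : ℝ) := by fun_prop
    exact (h1.comp (comap_measurable
      (fun ω => (N (gridTime T M (n + 1)) ω : ℝ) - N (gridTime T M n) ω))).comap_le
  · intro n
    refine isSmallNoise_of_hasLaw_stdGaussian (by positivity) hδT ?_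
    have h1 := hW.law_increment _ _ (hle n)
    rwa [gridTime_succ, NNReal.coe_add, add_sub_cancel_left, hδ, ← gridTime_succ] at h1
  · intro n
    rw [hν, ← hδ]
    refine isSmallNoise_of_hasLaw_poissonMeasure (T := T) (by rwa [hδ]) ?_
    have h1 := hN.law_increment _ _ (hle n)
    rwa [gridTime_succ, add_tsub_cancel_left, ← gridTime_succ] at h1

lemma compensatedTamedEuler_eq_noisyRecursion {d m : ℕ}
    (f : EuclideanSpace ℝ (Fin d) → EuclideanSpace ℝ (Fin d))
    (g : EuclideanSpace ℝ (Fin d) → EuclideanSpace ℝ (Fin m) →L[ℝ] EuclideanSpace ℝ (Fin d))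
    (h : EuclideanSpace ℝ (Fin d) → EuclideanSpace ℝ (Fin d))
    (lam T : ℝ≥0) (X₀ : Ω → EuclideanSpace ℝ (Fin d))
    (W : ℝ≥0 → Ω → EuclideanSpace ℝ (Fin m)) (N : ℝ≥0 → Ω → ℕ) (M n : ℕ) :
    compensatedTamedEuler f g h lam T X₀ W N M n =
      noisyRecursion (tamedStep (compensatedDrift f h lam) ((T : ℝ) / M)) h g X₀
        (fun n ω => W (gridTime T M (n + 1)) ω - W (gridTime T M n) ω)
        (fun n ω => compensated N lam (gridTime T M (n + 1)) ω -
          compensated N lam (gridTime T M n) ω) n := by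
  induction n with
  | zero => rfl
  | succ n ih =>
    ext1 ω
    simp only [compensatedTamedEuler, noisyRecursion, ← ih, tamedStep, add_assoc]

lemma integrable_one_add_norm_sq_pow [IsFiniteMeasure P] {E : Type*} [NormedAddCommGroup E]
    {X : Ω → E} (hX : AEStronglyMeasurable X P)
    (hp : ∀ p : ℝ, 0 < p → ∫⁻ ω, ‖X ω‖ₑ ^ p ∂P < ∞) (j : ℕ) :
    Integrable (fun ω => (1 + ‖X ω‖ ^ 2) ^ j) P := by
  have h1 : Integrable (fun ω => ‖X ω‖ ^ (2 * j)) P := by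
    rcases Nat.eq_zero_or_pos j with rfl | hj
    · simp
    · refine ⟨hX.norm.pow _, ?_⟩
      have h2 := hp ((2 * j : ℕ) : ℝ) (by positivity)
      simp only [ENNReal.rpow_natCast] at h2
      simpa [HasFiniteIntegral, enorm_pow] using h2
  refine (((integrable_const (1 : ℝ)).fun_add h1).const_mul (2 ^ j)).mono'
    ((hX.norm.pow 2).const_add 1 |>.pow j) (ae_of_all _ fun ω => ?_)
  rw [Real.norm_of_nonneg (by positivity), pow_mul]
  simpa using add_pow_le_two_pow_mul zero_le_one (sq_nonneg ‖X ω‖) j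

lemma enorm_rpow_le_ofReal_one_add_norm_sq_pow {E : Type*} [NormedAddCommGroup E] (y : E) {p : ℝ}
    (hp : 0 ≤ p) : ‖y‖ₑ ^ p ≤ ENNReal.ofReal ((1 + ‖y‖ ^ 2) ^ ⌈p⌉₊) := by
  rw [← ofReal_norm, ENNReal.ofReal_rpow_of_nonneg (norm_nonneg y) hp]
  apply ENNReal.ofReal_le_ofReal
  have h1 : ‖y‖ ≤ 1 + ‖y‖ ^ 2 := by nlinarith [sq_nonneg (‖y‖ - 1), sq_nonneg ‖y‖]
  calc ‖y‖ ^ p ≤ (1 + ‖y‖ ^ 2) ^ p := by gcongr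
    _ ≤ (1 + ‖y‖ ^ 2) ^ (⌈p⌉₊ : ℝ) :=
      Real.rpow_le_rpow_of_exponent_le (by linarith [sq_nonneg ‖y‖]) (Nat.le_ceil p)
    _ = _ := Real.rpow_natCast _ _

end Scheme

theorem theorem4p1 {Ω : Type*} {mΩ : MeasurableSpace Ω} (P : Measure Ω) [IsProbabilityMeasure P]
    (ℱ : Filtration ℝ≥0 mΩ) {d m : ℕ}
    (W : ℝ≥0 → Ω → EuclideanSpace ℝ (Fin m)) (hW : IsFilteredBrownianMotion W ℱ P)
    (lam : ℝ≥0) (hlam : 0 < lam)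
    (N : ℝ≥0 → Ω → ℕ) (hN : IsFilteredPoissonProcess N lam ℱ P)
    (T : ℝ≥0) (hT : 0 < T)
    (X₀ : Ω → EuclideanSpace ℝ (Fin d)) (hX₀ : Measurable[ℱ 0] X₀)
    (hX₀_moments : ∀ p : ℝ, 0 < p → ∫⁻ ω, ‖X₀ ω‖ₑ ^ p ∂P < ∞)
    (f : EuclideanSpace ℝ (Fin d) → EuclideanSpace ℝ (Fin d))
    (g : EuclideanSpace ℝ (Fin d) → EuclideanSpace ℝ (Fin m) →L[ℝ] EuclideanSpace ℝ (Fin d))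
    (h : EuclideanSpace ℝ (Fin d) → EuclideanSpace ℝ (Fin d))
    (hf : ContDiff ℝ 1 f) (hg : ContDiff ℝ 1 g) (hh : ContDiff ℝ 1 h)
    (C K c : ℝ) (hC : 0 < C) (hK : 0 < K) (hc : 0 < c)
    (hgh_lip : ∀ x y, max ‖g x - g y‖ ‖h x - h y‖ ≤ C * ‖x - y‖)
    (hf_one_sided : ∀ x y, ⟪x - y, f x - f y⟫ ≤ C * ‖x - y‖ ^ 2)
    (hf_growth : ∀ x y, ‖f x - f y‖ ≤ C * (K + ‖x‖ ^ c + ‖y‖ ^ c) * ‖x - y‖) :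
    (∀ M : ℕ, 1 ≤ M → ∀ n ≤ M, Measurable (compensatedTamedEuler f g h lam T X₀ W N M n)) ∧
    ∀ p : ℝ, 1 ≤ p →
      (⨆ (M : ℕ) (_ : 1 ≤ M) (n : ℕ) (_ : n ≤ M),
        ∫⁻ ω, ‖compensatedTamedEuler f g h lam T X₀ W N M n ω‖ₑ ^ p ∂P) < ∞ := by
  obtain ⟨Q₁, Q₂, hnoise⟩ := exists_isAdaptedNoise_increments hW hN T
  have hgm : Measurable g := hg.continuous.measurable
  have hhm : Measurable h := hh.continuous.measurable
  have hbm : Measurable (compensatedDrift f h lam) :=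
    hf.continuous.measurable.add (hhm.const_smul (lam : ℝ))
  have hb0 : ∀ M : ℕ, Measurable (tamedStep (compensatedDrift f h lam) ((T : ℝ) / M)) := fun M => by
    unfold tamedStep; fun_prop
  refine ⟨fun M hM n _ => ?_, fun p hp => ?_⟩
  · obtain ⟨𝒢, h𝒢, hnz⟩ := hnoise M hM
    rw [compensatedTamedEuler_eq_noisyRecursion]
    exact (measurable_noisyRecursion hnz (hb0 M) hhm hgm (h𝒢 ▸ hX₀) n).mono (𝒢.le n) le_rfl
  have hgG := norm_le_mul_sqrt_of_lipschitz hC.le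
    fun x y => (le_max_left _ _).trans (hgh_lip x y)
  have hhH := norm_le_mul_sqrt_of_lipschitz hC.le
    fun x y => (le_max_right _ _).trans (hgh_lip x y)
  set G := ‖g 0‖ + C with hG
  set H := ‖h 0‖ + C with hH
  have hG0 : 0 ≤ G := by positivity
  have hH0 : 0 ≤ H := by positivity
  set B₁ := C + ‖f 0‖ + lam * H with hB₁
  set B₂ := (‖f 0‖ + C * (K + 1) + lam * H) ^ 2 with hB₂
  have hB₁0 : 0 ≤ B₁ := by positivity
  have hB₂0 : 0 ≤ B₂ := by positivity
  -- A single constant `A` dominates the four growth constants, and the real moment order `p` is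
  -- replaced by the integer `⌈p⌉₊`.
  obtain ⟨D, -, hD⟩ := exists_integral_pow_tamed_le (P := P) (A := B₁ + B₂ + G + H)
    (by positivity) (NNReal.coe_pos.2 hT) Q₁ Q₂ hbm hhm hgm (⌈c⌉₊ + 1)
    (fun y => (inner_compensatedDrift_le lam hC.le hf_one_sided hhH y).trans
      (mul_le_mul_of_nonneg_right (by linarith) (by positivity)))
    (fun y => (norm_compensatedDrift_sq_le lam hC.le hK.le hc hH0 hf_growth hhH y).trans
      (mul_le_mul_of_nonneg_right (by linarith) (by positivity)))
    (fun y => (hgG y).trans (by gcongr; linarith))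
    (fun y => (hhH y).trans (by gcongr; linarith))
    (integrable_one_add_norm_sq_pow (hX₀.mono (ℱ.le 0) le_rfl).aestronglyMeasurable hX₀_moments)
    ⌈p⌉₊
  refine lt_of_le_of_lt ?_ (ENNReal.ofReal_lt_top (r := D))
  refine iSup₂_le fun M hM => iSup₂_le fun n hn => ?_
  obtain ⟨𝒢, h𝒢, hnz⟩ := hnoise M hM
  obtain ⟨hint, hle⟩ := hD M 𝒢 _ _ hM (h𝒢 ▸ hX₀) hnz n hn
  rw [compensatedTamedEuler_eq_noisyRecursion]
  refine (lintegral_mono fun ω =>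
    enorm_rpow_le_ofReal_one_add_norm_sq_pow _ (zero_le_one.trans hp)).trans ?_
  rw [← ofReal_integral_eq_lintegral_ofReal hint (ae_of_all _ fun ω => by positivity)]
  exact ENNReal.ofReal_le_ofReal hle
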